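/- Let $d\ge 2$ and let $\ell_\infty^d$ be $\mathbb{R}^d$ with the norm $\|x\|_\infty=\max_i|x_i|$. A support functional of a norm $\|\cdot\|_X$ on $\mathbb{R}^d$ at a unit vector $x_0$ is a linear functional $\varphi$ with $\varphi(x_0)=1$ and dual norm $1$; the norm is smooth at $x_0$ if there is exactly one. For a finite simple graph $G=(V,E)$, a framework $(G,p)$ in $X=(\mathbb{R}^d,\|\cdot\|_X)$ is given by points $p=(p_v)_{v\in V}\in(\mathbb{R}^d)^V$ such that for each edge $vw$ we have $p_v\ne p_w$ and the norm is smooth at $(p_v-p_w)/\|p_v-p_w\|_X$; let $\varphi_{v,w}$ be the support functional at that point. The rigidity matrix $R(G,p)\in\mathbb{R}^{E\times(V\times[d])}$ has entry $\varphi_{v,w}(b_i)$ at $(e,(v,i))$ if $e=vw$ (with $b_1,\dots,b_d$ the standard basis), and $0$ if $v$ is not an end of $e$. Put $L(G,p)=R(G,p)^\top R(G,p)$ and let $\lambda_1\le\lambda_2\le\cdots$ be the eigenvalues of a real symmetric matrix, with multiplicity. A rigid motion of $X$ is a family of continuous paths $\alpha_x:(-1,1)\to\mathbb{R}^d$ $(x\in\mathbb{R}^d)$,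 each differentiable at $0$, with $\alpha_x(0)=x$ and $\|\alpha_x(t)-\alpha_y(t)\|_X=\|x-y\|_X$ for all $x,y,t$; let $k(X)$ be the dimension of the linear space of the maps $x\mapsto\alpha_x'(0)$ that arise from rigid motions. The algebraic connectivity of $G$ in $X$ is $$a(G,X)=\sup\{\lambda_{k(X)+1}(L(G,p)) : (G,p)\text{ is a framework in }X\}.$$ Theorem. Let $d\ge2$ and let $G=(V,E)$ be a finite simple graph with $|V|\ge d+1$ and $|E|\le d|V|$. Then the supremum defining $a(G,\ell_\infty^d)$ is taken over a nonempty set that is bounded above, and (i) $a(G,\ell_\infty^d)\le 1$; (ii) $a(G,\ell_\infty^d)=1$ if and only if $d=2$ and $G$ is (isomorphic to) the octahedral graph $K_{2,2,2}$. -/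

import Mathlib

noncomputable section

namespace NormedRigidity

/-! ## Normed spaces

A `d`-dimensional real normed space `X = (ℝ^d, ‖·‖_X)` is represented by its norm
`X : Seminorm ℝ (Fin d → ℝ)`. -/

/-- The space `ℓ_∞^d`: the norm `‖x‖_∞ = max_i |x_i|` on `ℝ^d`. -/
def lInfty (d : ℕ) : Seminorm ℝ (Fin d → ℝ) := normSeminorm ℝ (Fin d → ℝ)

/-- The dual norm `‖φ‖_X^* = sup {|φ x| : ‖x‖_X = 1}` of a linear functional `φ` on `ℝ^d`. -/
def dualNorm {d : ℕ} (X : Seminorm ℝ (Fin d → ℝ)) (φ : (Fin d → ℝ) →ₗ[ℝ] ℝ) : ℝ :=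
  sSup {r : ℝ | ∃ x : Fin d → ℝ, X x = 1 ∧ r = |φ x|}

/-- `φ` is a support functional for the point `x₀` of the unit sphere of `X`. -/
def IsSupportFunctional {d : ℕ} (X : Seminorm ℝ (Fin d → ℝ)) (x₀ : Fin d → ℝ)
    (φ : (Fin d → ℝ) →ₗ[ℝ] ℝ) : Prop :=
  φ x₀ = 1 ∧ dualNorm X φ = 1

/-- The norm of `X` is smooth at the point `x₀` of the unit sphere: there is exactly one support
functional for `x₀`. -/
def IsSmoothAt {d : ℕ} (X : Seminorm ℝ (Fin d → ℝ)) (x₀ : Fin d → ℝ) : Prop :=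
  X x₀ = 1 ∧ ∃! φ : (Fin d → ℝ) →ₗ[ℝ] ℝ, IsSupportFunctional X x₀ φ

open Classical in
/-- The unique support functional for `x₀`, where the norm is smooth (and `0` elsewhere). -/
def supportFunctional {d : ℕ} (X : Seminorm ℝ (Fin d → ℝ)) (x₀ : Fin d → ℝ) :
    (Fin d → ℝ) →ₗ[ℝ] ℝ :=
  if h : IsSmoothAt X x₀ then h.2.choose else 0

/-- A rigid motion of `X`: a family of continuous paths `α x : (-1, 1) → ℝ^d`, `x ∈ ℝ^d`, with
`α x 0 = x`, differentiable at `0`, and preserving all distances at all times.  (Only the values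
of `α x` on the interval `(-1, 1)` matter.) -/
structure IsRigidMotion {d : ℕ} (X : Seminorm ℝ (Fin d → ℝ))
    (α : (Fin d → ℝ) → ℝ → (Fin d → ℝ)) : Prop where
  continuousOn : ∀ x, ContinuousOn (α x) (Set.Ioo (-1) 1)
  map_zero : ∀ x, α x 0 = x
  differentiableAt : ∀ x, DifferentiableAt ℝ (α x) 0
  isometry : ∀ t ∈ Set.Ioo (-1 : ℝ) 1, ∀ x y, X (α x t - α y t) = X (x - y)

/-- `η` is an infinitesimal rigid motion of `X`: it is `x ↦ (α x)'(0)` for a rigid motion `α`. -/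
def IsInfinitesimalRigidMotion {d : ℕ} (X : Seminorm ℝ (Fin d → ℝ))
    (η : (Fin d → ℝ) → (Fin d → ℝ)) : Prop :=
  ∃ α : (Fin d → ℝ) → ℝ → (Fin d → ℝ), IsRigidMotion X α ∧ ∀ x, η x = deriv (α x) 0

/-- The linear space `𝒯(X)` of infinitesimal rigid motions of `X`, as a subspace of the space of
maps `ℝ^d → ℝ^d` with pointwise operations.  (The infinitesimal rigid motions of a normed space
are closed under these operations, so the span adds nothing.) -/
def infinitesimalRigidMotions {d : ℕ} (X : Seminorm ℝ (Fin d → ℝ)) :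
    Submodule ℝ ((Fin d → ℝ) → (Fin d → ℝ)) :=
  Submodule.span ℝ {η | IsInfinitesimalRigidMotion X η}

/-- `k(X)`, the dimension of the space of infinitesimal rigid motions of `X`. -/
def motionDim {d : ℕ} (X : Seminorm ℝ (Fin d → ℝ)) : ℕ :=
  Module.finrank ℝ (infinitesimalRigidMotions X)

/-! ## Frameworks -/

/-- The vector `x` scaled to have norm one. -/
def normalise {d : ℕ} (X : Seminorm ℝ (Fin d → ℝ)) (x : Fin d → ℝ) : Fin d → ℝ :=
  (X x)⁻¹ • x

/-- `(G, p)` is a framework in `X`: for each edge `vw` the points `p v`, `p w` are distinct and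
the norm is smooth at the normalised vector `(p v - p w) / ‖p v - p w‖`. -/
def IsFramework {V : Type*} {d : ℕ} (G : SimpleGraph V) (X : Seminorm ℝ (Fin d → ℝ))
    (p : V → Fin d → ℝ) : Prop :=
  ∀ v w, G.Adj v w → p v ≠ p w ∧ IsSmoothAt X (normalise X (p v - p w))

open Classical in
/-- The rigidity matrix `R(G, p)`, with rows indexed by the edges of `G` and columns indexed by
`V × [d]`: the entry at `(e, (v, i))` is `φ_{v,w}(b_i)` if `e = vw`, and `0` if `v` is not an end
of `e`. Here `φ_{v,w}` is the support functional for the normalised vector from `p w` to `p v`. -/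
def rigidityMatrix {V : Type*} {d : ℕ} (G : SimpleGraph V) (X : Seminorm ℝ (Fin d → ℝ))
    (p : V → Fin d → ℝ) : Matrix G.edgeSet (V × Fin d) ℝ :=
  Matrix.of fun e vi =>
    if h : vi.1 ∈ (e : Sym2 V) then
      supportFunctional X (normalise X (p vi.1 - p (Sym2.Mem.other h))) (Pi.single vi.2 1)
    else 0

open Classical in
/-- The framework Laplacian matrix `L(G, p) = R(G, p)ᵀ R(G, p)`. -/
def frameworkLaplacian {V : Type*} [Fintype V] {d : ℕ} (G : SimpleGraph V)
    (X : Seminorm ℝ (Fin d → ℝ)) (p : V → Fin d → ℝ) : Matrix (V × Fin d) (V × Fin d) ℝ :=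
  (rigidityMatrix G X p).transpose * rigidityMatrix G X p

theorem frameworkLaplacian_isHermitian {V : Type*} [Fintype V] {d : ℕ} (G : SimpleGraph V)
    (X : Seminorm ℝ (Fin d → ℝ)) (p : V → Fin d → ℝ) :
    (frameworkLaplacian G X p).IsHermitian := by
  rw [Matrix.IsHermitian, Matrix.conjTranspose_eq_transpose_of_trivial]
  simp [frameworkLaplacian, Matrix.transpose_mul]

open Classical in
/-- `λ_j(A)`: the `j`-th smallest eigenvalue (`1 ≤ j ≤ n`, counted with multiplicity) of a real
symmetric `n × n` matrix `A`. Mathlib lists the eigenvalues in decreasing order, starting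
with index `0`, so this is the entry of index `n - j`. -/
def nthEigenvalue {n : Type*} [Fintype n] (A : Matrix n n ℝ) (hA : A.IsHermitian) (j : ℕ) : ℝ :=
  if h : 1 ≤ j ∧ j ≤ Fintype.card n then
    hA.eigenvalues₀ ⟨Fintype.card n - j, by omega⟩
  else 0

/-- The rigidity eigenvalue `λ_{k(X)+1}(L(G, p))`. -/
def rigidityEigenvalue {V : Type*} [Fintype V] {d : ℕ} (G : SimpleGraph V)
    (X : Seminorm ℝ (Fin d → ℝ)) (p : V → Fin d → ℝ) : ℝ :=
  nthEigenvalue (frameworkLaplacian G X p) (frameworkLaplacian_isHermitian G X p)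
    (motionDim X + 1)

/-- The set of the rigidity eigenvalues of all frameworks `(G, p)` in `X`. -/
def rigidityEigenvalues {V : Type*} [Fintype V] {d : ℕ} (G : SimpleGraph V)
    (X : Seminorm ℝ (Fin d → ℝ)) : Set ℝ :=
  {r | ∃ p : V → Fin d → ℝ, IsFramework G X p ∧ r = rigidityEigenvalue G X p}

/-- The algebraic connectivity `a(G, X)` of `G` in `X`. -/
def algConnectivity {V : Type*} [Fintype V] {d : ℕ} (G : SimpleGraph V)
    (X : Seminorm ℝ (Fin d → ℝ)) : ℝ :=
  sSup (rigidityEigenvalues G X)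

/-- The octahedral graph `K_{2,2,2}`. -/
abbrev octahedralGraph : SimpleGraph (Σ _ : Fin 3, Fin 2) :=
  SimpleGraph.completeMultipartiteGraph fun _ : Fin 3 => Fin 2

end NormedRigidity

end

noncomputable section

namespace NormedRigidity

/-! The norm of `ℓ_∞^d` is smooth exactly where one coordinate strictly dominates, and the support
functional there is plus or minus that coordinate. A framework therefore colours each edge by a
coordinate, and `L(G, p)` splits into `d` blocks, the ordinary graph Laplacians of the colour
classes (`two_mul_dotProduct_frameworkLaplacian`). Infinitesimal rigid motions are translations, so
`k = d`, and the rigidity eigenvalue is the least algebraic connectivity of a colour class.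

With at most `d|V|` edges, either some colour class has a vertex of degree at most 1, or all classes
are 2-regular and `G` is `2d`-regular (`degree_eq_of_two_le`). An isolated vertex gives a value
below 1. So does a pendant vertex, because its neighbour also has an edge of another colour and so
misses some vertex in this one. In a 2-regular class, test functions supported on two distant paths
give at most 1 on six vertices and less than 1 on seven or more. Since `2d < |V|`, fewer than six
vertices forces `K_5` with `d = 2`. A 2-regular class would be a 5-cycle, but the coordinate orients
it transitively, and an odd cycle longer than a triangle has no transitive orientation. What remains
is `d = 2` and a 4-regular graph on six vertices, the octahedron.

Conversely, an explicit placement splits the octahedron into two hexagons, whose algebraic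
connectivity is 1. Only finitely many matrices occur, so the supremum is attained, and strict bounds
for single frameworks survive. -/

open Matrix

/-! ### Courant–Fischer bounds -/

open Classical in
/-- The coordinates of a vector in an orthonormal basis of eigenvectors. -/
def eigenCoord {n : Type*} [Fintype n] {A : Matrix n n ℝ} (hA : A.IsHermitian) :
    (n → ℝ) →ₗ[ℝ] (n → ℝ) :=
  Matrix.mulVecLin (star (hA.eigenvectorUnitary : Matrix n n ℝ))

open Classical in
theorem dotProduct_eq_sum_eigenCoord {n : Type*} [Fintype n] {A : Matrix n n ℝ}
    (hA : A.IsHermitian) (x : n → ℝ) : x ⬝ᵥ x = ∑ i, eigenCoord hA x i ^ 2 := by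
  have h : ∑ i, eigenCoord hA x i ^ 2 = eigenCoord hA x ⬝ᵥ eigenCoord hA x := by
    simp [dotProduct, sq]
  have hU : (star (hA.eigenvectorUnitary : Matrix n n ℝ))ᵀ = hA.eigenvectorUnitary := by
    ext i j
    simp [Matrix.star_apply]
  rw [h]
  simp only [eigenCoord, Matrix.mulVecLin_apply]
  rw [Matrix.dotProduct_mulVec, Matrix.vecMul_mulVec, hU,
    Unitary.mul_star_self_of_mem hA.eigenvectorUnitary.2,
    Matrix.vecMul_one]

open Classical in
theorem dotProduct_mulVec_eq_sum_eigenCoord {n : Type*} [Fintype n] {A : Matrix n n ℝ}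
    (hA : A.IsHermitian) (x : n → ℝ) :
    x ⬝ᵥ A *ᵥ x = ∑ i, hA.eigenvalues i * eigenCoord hA x i ^ 2 := by
  have h : ∑ i, hA.eigenvalues i * eigenCoord hA x i ^ 2
      = eigenCoord hA x ⬝ᵥ (diagonal hA.eigenvalues) *ᵥ eigenCoord hA x := by
    simp only [dotProduct, sq, mulVec_diagonal]
    exact Finset.sum_congr rfl fun i _ => by ring
  rw [h]
  conv_lhs => rw [hA.spectral_theorem, Unitary.conjStarAlgAut_apply]
  simp only [eigenCoord, Matrix.mulVecLin_apply, ← Matrix.mulVec_mulVec]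
  rw [Matrix.dotProduct_mulVec]
  congr 1
  ext i
  simp [Matrix.vecMul, Matrix.mulVec, dotProduct, Matrix.star_apply, mul_comm]

-- Vanishing on `s` imposes `s.card` linear conditions, fewer than the dimension of `W`.
open Classical in
theorem exists_mem_eigenCoord_eq_zero {n : Type*} [Fintype n] {A : Matrix n n ℝ}
    (hA : A.IsHermitian) (W : Submodule ℝ (n → ℝ)) (s : Finset n)
    (hs : s.card < Module.finrank ℝ W) :
    ∃ x ∈ W, x ≠ 0 ∧ ∀ i ∈ s, eigenCoord hA x i = 0 := by
  let f : W →ₗ[ℝ] (s → ℝ) :=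
    (LinearMap.funLeft ℝ ℝ (fun i : s => (i : n))) ∘ₗ eigenCoord hA ∘ₗ W.subtype
  have hf : LinearMap.ker f ≠ ⊥ := f.ker_ne_bot_of_finrank_lt (by simpa using hs)
  obtain ⟨x, hx, hx0⟩ := (Submodule.ne_bot_iff _).1 hf
  refine ⟨x, x.2, by simpa using hx0, fun i hi => ?_⟩
  exact congrFun (LinearMap.mem_ker.1 hx) ⟨i, hi⟩

theorem dotProduct_self_pos' {n : Type*} [Fintype n] {x : n → ℝ} (hx : x ≠ 0) : 0 < x ⬝ᵥ x := by
  have h0 : 0 ≤ x ⬝ᵥ x := Finset.sum_nonneg fun i _ => mul_self_nonneg _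
  exact lt_of_le_of_ne h0 fun h => hx (dotProduct_self_eq_zero.1 h.symm)

/-- The easy half of the Courant–Fischer theorem, from above. -/
theorem nthEigenvalue_le {n : Type*} [Fintype n] {A : Matrix n n ℝ} (hA : A.IsHermitian) {j : ℕ}
    (h1 : 1 ≤ j) (hj : j ≤ Fintype.card n) {μ : ℝ} (W : Submodule ℝ (n → ℝ))
    (hW : j ≤ Module.finrank ℝ W) (h : ∀ x ∈ W, x ⬝ᵥ A *ᵥ x ≤ μ * (x ⬝ᵥ x)) :
    nthEigenvalue A hA j ≤ μ := by
  classical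
  rw [nthEigenvalue, dif_pos ⟨h1, hj⟩]
  -- This is the relabelling used by `eigenvalues`, so `hA.eigenvalues i` unfolds to
  -- `hA.eigenvalues₀ (e.symm i)`.
  set e : Fin (Fintype.card n) ≃ n := Fintype.equivOfCardEq (Fintype.card_fin _) with he
  -- The `j - 1` indices above `n - j` carry the smallest eigenvalues; a subspace of dimension at
  -- least `j` contains a nonzero vector without components there.
  obtain ⟨x, hxW, hx0, hx⟩ := exists_mem_eigenCoord_eq_zero hA W
    ((Finset.Ioi (⟨Fintype.card n - j, by omega⟩ : Fin (Fintype.card n))).map e.toEmbedding)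
    (by rw [Finset.card_map, Fin.card_Ioi]; simp only; omega)
  set l := hA.eigenvalues₀ ⟨Fintype.card n - j, by omega⟩
  have key : l * (x ⬝ᵥ x) ≤ x ⬝ᵥ A *ᵥ x := by
    rw [dotProduct_mulVec_eq_sum_eigenCoord hA, dotProduct_eq_sum_eigenCoord hA, Finset.mul_sum]
    refine Finset.sum_le_sum fun i _ => ?_
    by_cases hi : e.symm i ≤ ⟨Fintype.card n - j, by omega⟩
    · exact mul_le_mul_of_nonneg_right (hA.eigenvalues₀_antitone hi) (sq_nonneg _)
    · rw [hx i (by simpa using not_le.1 hi)]; simp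
  have := key.trans (h x hxW)
  exact le_of_mul_le_mul_right this (dotProduct_self_pos' hx0)

/-- The easy half of the Courant–Fischer theorem, from below. -/
theorem le_nthEigenvalue {n : Type*} [Fintype n] {A : Matrix n n ℝ} (hA : A.IsHermitian) {j : ℕ}
    (h1 : 1 ≤ j) (hj : j ≤ Fintype.card n) {μ : ℝ} (W : Submodule ℝ (n → ℝ))
    (hW : Fintype.card n + 1 ≤ j + Module.finrank ℝ W)
    (h : ∀ x ∈ W, μ * (x ⬝ᵥ x) ≤ x ⬝ᵥ A *ᵥ x) :
    μ ≤ nthEigenvalue A hA j := by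
  classical
  rw [nthEigenvalue, dif_pos ⟨h1, hj⟩]
  set e : Fin (Fintype.card n) ≃ n := Fintype.equivOfCardEq (Fintype.card_fin _) with he
  -- Dually, the `n - j` indices below `n - j` carry the largest eigenvalues, and `W` has dimension
  -- at least `n - j + 1`.
  obtain ⟨x, hxW, hx0, hx⟩ := exists_mem_eigenCoord_eq_zero hA W
    ((Finset.Iio (⟨Fintype.card n - j, by omega⟩ : Fin (Fintype.card n))).map e.toEmbedding)
    (by rw [Finset.card_map, Fin.card_Iio]; simp only; omega)
  set l := hA.eigenvalues₀ ⟨Fintype.card n - j, by omega⟩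
  have key : x ⬝ᵥ A *ᵥ x ≤ l * (x ⬝ᵥ x) := by
    rw [dotProduct_mulVec_eq_sum_eigenCoord hA, dotProduct_eq_sum_eigenCoord hA, Finset.mul_sum]
    refine Finset.sum_le_sum fun i _ => ?_
    by_cases hi : ⟨Fintype.card n - j, by omega⟩ ≤ e.symm i
    · exact mul_le_mul_of_nonneg_right (hA.eigenvalues₀_antitone hi) (sq_nonneg _)
    · rw [hx i (by simpa using not_le.1 hi)]; simp
  have := (h x hxW).trans key
  exact le_of_mul_le_mul_right this (dotProduct_self_pos' hx0)

/-! ### Smooth points and support functionals of the maximum norm -/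

/-- The coordinate `i` of `x` is strictly larger in absolute value than all the others. -/
def IsDominant {d : ℕ} (x : Fin d → ℝ) (i : Fin d) : Prop :=
  ∀ j, j ≠ i → |x j| < |x i|

theorem IsDominant.unique {d : ℕ} {x : Fin d → ℝ} {i j : Fin d} (hi : IsDominant x i)
    (hj : IsDominant x j) : i = j := by
  by_contra h
  exact lt_asymm (hi j (Ne.symm h)) (hj i h)

theorem IsDominant.le {d : ℕ} {x : Fin d → ℝ} {i : Fin d} (hi : IsDominant x i) (j : Fin d) :
    |x j| ≤ |x i| := by
  rcases eq_or_ne j i with rfl | h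
  · exact le_rfl
  · exact (hi j h).le

theorem IsDominant.neg {d : ℕ} {x : Fin d → ℝ} {i : Fin d} (hi : IsDominant x i) :
    IsDominant (-x) i := fun j hj => by simpa using hi j hj

theorem IsDominant.sub_comm {d : ℕ} {x y : Fin d → ℝ} {i : Fin d} (hi : IsDominant (x - y) i) :
    IsDominant (y - x) i := by simpa using hi.neg

theorem isDominant_smul_iff {d : ℕ} {x : Fin d → ℝ} {i : Fin d} {c : ℝ} (hc : c ≠ 0) :
    IsDominant (c • x) i ↔ IsDominant x i := by
  have : 0 < |c| := abs_pos.2 hc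
  simp [IsDominant, abs_mul, this]

@[simp]
theorem lInfty_apply {d : ℕ} (x : Fin d → ℝ) : lInfty d x = ‖x‖ := rfl

theorem norm_eq_abs_of_isMax {d : ℕ} {x : Fin d → ℝ} {i : Fin d} (hi : ∀ j, |x j| ≤ |x i|) :
    ‖x‖ = |x i| :=
  le_antisymm ((pi_norm_le_iff_of_nonneg (abs_nonneg _)).2 hi) (norm_le_pi_norm x i)

theorem exists_norm_eq_abs {d : ℕ} {x : Fin d → ℝ} (hx : x ≠ 0) : ∃ i, ‖x‖ = |x i| := by
  obtain ⟨j, -⟩ := Function.ne_iff.1 hx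
  have : Nonempty (Fin d) := ⟨j⟩
  obtain ⟨i, hi⟩ := Finite.exists_max fun i => |x i|
  exact ⟨i, norm_eq_abs_of_isMax hi⟩

theorem linearMap_apply_eq_sum {d : ℕ} (φ : (Fin d → ℝ) →ₗ[ℝ] ℝ) (x : Fin d → ℝ) :
    φ x = ∑ i, x i * φ (Pi.single i 1) := by
  conv_lhs => rw [LinearMap.pi_apply_eq_sum_univ φ x]
  refine Finset.sum_congr rfl fun i _ => ?_
  rw [smul_eq_mul]
  congr 2
  ext j
  simp [Pi.single_apply, eq_comm]

theorem bddAbove_dualNorm_set {d : ℕ} (φ : (Fin d → ℝ) →ₗ[ℝ] ℝ) :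
    BddAbove {r : ℝ | ∃ x : Fin d → ℝ, lInfty d x = 1 ∧ r = |φ x|} := by
  refine ⟨∑ i, |φ (Pi.single i 1)|, ?_⟩
  rintro _ ⟨x, hx, rfl⟩
  rw [linearMap_apply_eq_sum]
  refine (Finset.abs_sum_le_sum_abs _ _).trans (Finset.sum_le_sum fun i _ => ?_)
  rw [abs_mul]
  have h1 : |x i| ≤ 1 := by
    rw [← (show ‖x‖ = 1 from hx)]; exact norm_le_pi_norm x i
  exact mul_le_of_le_one_left (abs_nonneg _) h1

theorem IsSupportFunctional.abs_apply_le {d : ℕ} {x₀ : Fin d → ℝ} {φ : (Fin d → ℝ) →ₗ[ℝ] ℝ}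
    (h : IsSupportFunctional (lInfty d) x₀ φ) {x : Fin d → ℝ} (hx : ‖x‖ = 1) : |φ x| ≤ 1 := by
  rw [← h.2]
  exact le_csSup (bddAbove_dualNorm_set φ) ⟨x, hx, rfl⟩

theorem isSupportFunctional_proj {d : ℕ} {x₀ : Fin d → ℝ} {i : Fin d} (h0 : ‖x₀‖ = 1)
    (hi : |x₀ i| = 1) :
    IsSupportFunctional (lInfty d) x₀ (x₀ i • LinearMap.proj i) := by
  have h1 : x₀ i * x₀ i = 1 := by rw [← abs_mul_abs_self, hi, one_mul]
  refine ⟨by simpa using h1, le_antisymm (csSup_le ⟨_, x₀, h0, rfl⟩ ?_)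
    (le_csSup (bddAbove_dualNorm_set _) ⟨x₀, h0, by simp [h1]⟩)⟩
  rintro _ ⟨x, hx, rfl⟩
  simp only [LinearMap.smul_apply, LinearMap.proj_apply, smul_eq_mul, abs_mul, hi, one_mul]
  rw [← (show ‖x‖ = 1 from hx)]
  exact norm_le_pi_norm x i

/-- A coordinate `j ≠ i` has slack: `x₀` can move by `±ε` along it inside the unit sphere. As `φ x₀
= 1` is already maximal, `φ` vanishes on that direction. -/
theorem IsDominant.eq_of_isSupportFunctional {d : ℕ} {x₀ : Fin d → ℝ} {i : Fin d}
    (hi : IsDominant x₀ i) (h0 : ‖x₀‖ = 1) {φ : (Fin d → ℝ) →ₗ[ℝ] ℝ}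
    (hφ : IsSupportFunctional (lInfty d) x₀ φ) : φ = x₀ i • LinearMap.proj i := by
  have hx : |x₀ i| = 1 := by rw [← norm_eq_abs_of_isMax hi.le, h0]
  have h1 : x₀ i * x₀ i = 1 := by rw [← abs_mul_abs_self, hx, one_mul]
  have key : ∀ j, j ≠ i → φ (Pi.single j 1) = 0 := by
    intro j hj
    have hε : 0 < 1 - |x₀ j| := by have := hi j hj; linarith
    set ε := 1 - |x₀ j|
    have hn : ∀ c : ℝ, |c| = ε → |1 + c * φ (Pi.single j 1)| ≤ 1 := by
      intro c hc
      have hcoord : ∀ k, (x₀ + c • (Pi.single j 1 : Fin d → ℝ)) k = x₀ k + if k = j then c else 0 := by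
        intro k; simp [Pi.single_apply]
      have hi' : (x₀ + c • (Pi.single j 1 : Fin d → ℝ)) i = x₀ i := by
        rw [hcoord, if_neg hj.symm, add_zero]
      have hnorm : ‖x₀ + c • (Pi.single j 1 : Fin d → ℝ)‖ = 1 := by
        rw [norm_eq_abs_of_isMax (i := i), hi', hx]
        intro k
        rw [hi', hx, hcoord]
        split_ifs with hk
        · subst hk
          refine (abs_add_le _ _).trans ?_
          rw [hc]; simp [ε]
        · rw [add_zero, ← hx]; exact hi.le k
      have := hφ.abs_apply_le hnorm
      rwa [map_add, map_smul, hφ.1, smul_eq_mul] at this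
    have ha := (abs_le.1 (hn ε (abs_of_pos hε))).2
    have hb := (abs_le.1 (hn (-ε) (by rw [abs_neg, abs_of_pos hε]))).2
    have : ε * φ (Pi.single j 1) = 0 := by linarith
    exact (mul_eq_zero.1 this).resolve_left hε.ne'
  have hsum : ∀ x, φ x = x i * φ (Pi.single i 1) := by
    intro x
    rw [linearMap_apply_eq_sum]
    exact Finset.sum_eq_single i (fun j _ hj => by rw [key j hj, mul_zero]) (by simp)
  have hφi : φ (Pi.single i 1) = x₀ i := by
    have := hsum x₀
    rw [hφ.1] at this
    calc φ (Pi.single i 1) = (x₀ i * x₀ i) * φ (Pi.single i 1) := by rw [h1, one_mul]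
      _ = x₀ i * (x₀ i * φ (Pi.single i 1)) := by ring
      _ = x₀ i := by rw [← this, mul_one]
  refine LinearMap.ext fun x => ?_
  rw [hsum, hφi]
  simp [mul_comm]

/-- If two coordinates tie for the maximum, each yields its own support functional, contradicting
uniqueness. -/
theorem isSmoothAt_lInfty_iff {d : ℕ} (x₀ : Fin d → ℝ) :
    IsSmoothAt (lInfty d) x₀ ↔ ‖x₀‖ = 1 ∧ ∃ i, IsDominant x₀ i := by
  constructor
  · rintro ⟨h0, φ, -, huniq⟩
    have h0 : ‖x₀‖ = 1 := h0
    refine ⟨h0, ?_⟩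
    obtain ⟨i, hi⟩ := exists_norm_eq_abs (x := x₀) (by rintro rfl; simp at h0)
    rw [h0] at hi
    refine ⟨i, fun j hj => ?_⟩
    have hle : |x₀ j| ≤ 1 := h0 ▸ norm_le_pi_norm x₀ j
    rw [← hi]
    refine lt_of_le_of_ne hle fun hj1 => ?_
    have h := (huniq _ (isSupportFunctional_proj h0 hi.symm)).trans
      (huniq _ (isSupportFunctional_proj h0 hj1)).symm
    have h2 := LinearMap.congr_fun h (Pi.single i 1)
    have : x₀ i = 0 := by simpa [Pi.single_apply, hj] using h2
    rw [this] at hi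
    simp at hi
  · rintro ⟨h0, i, hi⟩
    have hx : |x₀ i| = 1 := by rw [← norm_eq_abs_of_isMax hi.le, h0]
    exact ⟨h0, _, isSupportFunctional_proj h0 hx, fun φ hφ => hi.eq_of_isSupportFunctional h0 hφ⟩

theorem IsDominant.supportFunctional_eq {d : ℕ} {x₀ : Fin d → ℝ} {i : Fin d}
    (hi : IsDominant x₀ i) (h0 : ‖x₀‖ = 1) :
    supportFunctional (lInfty d) x₀ = x₀ i • LinearMap.proj i := by
  have h : IsSmoothAt (lInfty d) x₀ := (isSmoothAt_lInfty_iff x₀).2 ⟨h0, i, hi⟩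
  rw [supportFunctional, dif_pos h]
  exact hi.eq_of_isSupportFunctional h0 h.2.choose_spec.1

theorem norm_normalise {d : ℕ} {x : Fin d → ℝ} (hx : x ≠ 0) : ‖normalise (lInfty d) x‖ = 1 := by
  simp [normalise, norm_smul, hx]

theorem isDominant_normalise_iff {d : ℕ} {x : Fin d → ℝ} (hx : x ≠ 0) {i : Fin d} :
    IsDominant (normalise (lInfty d) x) i ↔ IsDominant x i :=
  isDominant_smul_iff (by simpa using hx)

theorem isFramework_lInfty_iff {V : Type*} {d : ℕ} (G : SimpleGraph V) (p : V → Fin d → ℝ) :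
    IsFramework G (lInfty d) p ↔
      ∀ v w, G.Adj v w → p v ≠ p w ∧ ∃ i, IsDominant (p v - p w) i := by
  refine forall₃_congr fun v w _ => and_congr_right fun hne => ?_
  have h := sub_ne_zero.2 hne
  simp [isSmoothAt_lInfty_iff, norm_normalise h, isDominant_normalise_iff h]

/-! ### Infinitesimal rigid motions are translations -/

/-- For small `t` coordinate `i` of `α x t - α y t` stays dominant and keeps its sign. Preservation
of the norm then makes it constant. -/
theorem IsRigidMotion.deriv_apply_eq_of_isDominant {d : ℕ} {α : (Fin d → ℝ) → ℝ → (Fin d → ℝ)}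
    (hα : IsRigidMotion (lInfty d) α) {x y : Fin d → ℝ} {i : Fin d} (hi : IsDominant (x - y) i)
    (hxy : x i ≠ y i) :
    deriv (α x) 0 i = deriv (α y) 0 i := by
  set f : ℝ → (Fin d → ℝ) := fun t => α x t - α y t with hf
  have hf0 : f 0 = x - y := by simp [hf, hα.map_zero]
  have hdiff : HasDerivAt f (deriv (α x) 0 - deriv (α y) 0) 0 :=
    (hα.differentiableAt x).hasDerivAt.sub (hα.differentiableAt y).hasDerivAt
  have hcont : ContinuousAt f 0 := hdiff.continuousAt
  have hc : ∀ j, ContinuousAt (fun t => f t j) 0 := fun j =>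
    (continuous_apply j).continuousAt.comp hcont
  have hdom : ∀ᶠ t in nhds (0 : ℝ), IsDominant (f t) i := by
    refine Filter.eventually_all.2 fun j => ?_
    by_cases hj : j = i
    · simp [hj]
    · have : |f 0 j| < |f 0 i| := by rw [hf0]; exact hi j hj
      exact ((hc j).abs.eventually_lt (hc i).abs this).mono fun t ht _ => ht
  have hsign : ∀ᶠ t in nhds (0 : ℝ), 0 < f t i * f 0 i := by
    have h0 : 0 < f 0 i * f 0 i := by
      rw [hf0]; exact mul_self_pos.2 (sub_ne_zero.2 hxy)
    exact ((hc i).mul continuousAt_const).eventually (lt_mem_nhds h0)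
  have hIoo : ∀ᶠ t in nhds (0 : ℝ), t ∈ Set.Ioo (-1 : ℝ) 1 :=
    Ioo_mem_nhds (by norm_num) (by norm_num)
  have hconst : ∀ᶠ t in nhds (0 : ℝ), f t i = f 0 i := by
    filter_upwards [hdom, hsign, hIoo] with t ht hs hI
    have h1 : ‖f t‖ = ‖x - y‖ := hα.isometry t hI x y
    rw [norm_eq_abs_of_isMax ht.le, norm_eq_abs_of_isMax hi.le, ← hf0] at h1
    rcases abs_eq_abs.1 h1 with h | h
    · exact h
    · rw [h] at hs; nlinarith [mul_self_nonneg (f 0 i)]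
  have hderiv := (hasDerivAt_pi.1 hdiff i).deriv
  have h0 : deriv (fun t => f t i) 0 = 0 := by
    rw [Filter.EventuallyEq.deriv_eq (f := fun _ => f 0 i) hconst]; simp
  rw [h0] at hderiv
  have : deriv (α x) 0 i - deriv (α y) 0 i = 0 := hderiv.symm
  linarith

theorem IsRigidMotion.deriv_eq {d : ℕ} {α : (Fin d → ℝ) → ℝ → (Fin d → ℝ)}
    (hα : IsRigidMotion (lInfty d) α) (x y : Fin d → ℝ) : deriv (α x) 0 = deriv (α y) 0 := by
  ext i
  -- A third point, differing from `x` only in coordinate `i`, but by so much that `i` dominates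
  -- both `z - x` and `z - y`.
  set z : Fin d → ℝ := Function.update x i (|x i| + |y i| + ‖x - y‖ + 1) with hz
  have hzi : z i = |x i| + |y i| + ‖x - y‖ + 1 := by simp [hz]
  have hzj : ∀ j, j ≠ i → z j = x j := fun j hj => by simp [hz, hj]
  have h0 := norm_nonneg (x - y)
  have hx := abs_le.1 (le_refl |x i|)
  have hy := abs_le.1 (le_refl |y i|)
  have hzx : 0 < z i - x i := by rw [hzi]; linarith [abs_nonneg (y i)]
  have hzy : ‖x - y‖ < z i - y i := by rw [hzi]; linarith [abs_nonneg (x i)]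
  have h1 : IsDominant (z - x) i := fun j hj => by
    simp only [Pi.sub_apply, hzj j hj, sub_self, abs_zero]
    exact abs_pos.2 hzx.ne'
  have h2 : IsDominant (z - y) i := fun j hj => by
    simp only [Pi.sub_apply, hzj j hj]
    rw [abs_of_pos (h0.trans_lt hzy)]
    exact (norm_le_pi_norm (x - y) j).trans_lt hzy
  rw [← hα.deriv_apply_eq_of_isDominant h1 (by linarith),
    hα.deriv_apply_eq_of_isDominant h2 (by linarith)]

theorem isInfinitesimalRigidMotion_lInfty_iff {d : ℕ} (η : (Fin d → ℝ) → (Fin d → ℝ)) :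
    IsInfinitesimalRigidMotion (lInfty d) η ↔ ∃ c, η = fun _ => c := by
  constructor
  · rintro ⟨α, hα, hη⟩
    exact ⟨η 0, funext fun x => by rw [hη, hη, hα.deriv_eq x 0]⟩
  · rintro ⟨c, rfl⟩
    have hd : ∀ x : Fin d → ℝ, HasDerivAt (fun t : ℝ => x + t • c) c 0 := fun x => by
      simpa using ((hasDerivAt_id (0 : ℝ)).smul_const c).const_add x
    refine ⟨fun x t => x + t • c, ⟨fun x => ?_, fun x => by simp,
      fun x => (hd x).differentiableAt, fun t _ x y => by simp⟩, fun x => (hd x).deriv.symm⟩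
    fun_prop

theorem motionDim_lInfty (d : ℕ) : motionDim (lInfty d) = d := by
  let c : (Fin d → ℝ) →ₗ[ℝ] ((Fin d → ℝ) → (Fin d → ℝ)) := LinearMap.pi fun _ => LinearMap.id
  have hc : infinitesimalRigidMotions (lInfty d) = LinearMap.range c := by
    -- The constant maps already form a subspace, so the span in the definition adds nothing.
    rw [infinitesimalRigidMotions, ← Submodule.span_eq (LinearMap.range c)]
    congr 1
    ext η
    simp only [Set.mem_ofPred_eq, isInfinitesimalRigidMotion_lInfty_iff, SetLike.mem_coe,
      LinearMap.mem_range]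
    exact exists_congr fun a => ⟨fun h => h.symm, fun h => h.symm⟩
  have hinj : Function.Injective c := fun a b h => congrFun h 0
  rw [motionDim, hc, LinearMap.finrank_range_of_inj hinj]
  simp

/-! ### Colour classes and the quadratic form of the Laplacian -/

/-- The edges of `G` whose support functional is, up to sign, the coordinate `i`. -/
def colourGraph {V : Type*} {d : ℕ} (G : SimpleGraph V) (p : V → Fin d → ℝ) (i : Fin d) :
    SimpleGraph V where
  Adj v w := G.Adj v w ∧ IsDominant (p v - p w) i
  symm := ⟨fun _ _ h => ⟨h.1.symm, h.2.sub_comm⟩⟩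
  loopless := ⟨fun _ h => G.loopless.irrefl _ h.1⟩

theorem colourGraph_adj {V : Type*} {d : ℕ} {G : SimpleGraph V} {p : V → Fin d → ℝ} {i : Fin d}
    {v w : V} : (colourGraph G p i).Adj v w ↔ G.Adj v w ∧ IsDominant (p v - p w) i := Iff.rfl

open Classical in
/-- Twice the Dirichlet energy of a function on the vertices of a graph. -/
def energy {V : Type*} [Fintype V] (H : SimpleGraph V) (f : V → ℝ) : ℝ :=
  ∑ v, ∑ w, if H.Adj v w then (f v - f w) ^ 2 else 0

theorem energy_add_const {V : Type*} [Fintype V] (H : SimpleGraph V) (f : V → ℝ) (c : ℝ) :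
    energy H (fun v => f v + c) = energy H f := by
  simp [energy]

theorem energy_smul {V : Type*} [Fintype V] (H : SimpleGraph V) (f : V → ℝ) (c : ℝ) :
    energy H (fun v => c * f v) = c ^ 2 * energy H f := by
  simp only [energy, ← mul_sub, mul_pow, Finset.mul_sum, mul_ite, mul_zero]

theorem energy_const {V : Type*} [Fintype V] (H : SimpleGraph V) (c : ℝ) :
    energy H (fun _ => c) = 0 := by
  simp [energy]

theorem rigidityMatrix_apply {V : Type*} {d : ℕ} (G : SimpleGraph V) (X : Seminorm ℝ (Fin d → ℝ))
    (p : V → Fin d → ℝ) {v w : V} (h : G.Adj v w) (j : Fin d) :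
    rigidityMatrix G X p ⟨s(v, w), h⟩ (v, j) =
      supportFunctional X (normalise X (p v - p w)) (Pi.single j 1) := by
  have hm : v ∈ s(v, w) := Sym2.mem_mk_left v w
  have ho : Sym2.Mem.other hm = w := Sym2.congr_right.1 (Sym2.other_spec hm)
  simp [rigidityMatrix, ho]

theorem rigidityMatrix_apply_right {V : Type*} {d : ℕ} (G : SimpleGraph V)
    (X : Seminorm ℝ (Fin d → ℝ)) (p : V → Fin d → ℝ) {v w : V} (h : G.Adj v w) (j : Fin d) :
    rigidityMatrix G X p ⟨s(v, w), h⟩ (w, j) =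
      supportFunctional X (normalise X (p w - p v)) (Pi.single j 1) := by
  rw [← rigidityMatrix_apply G X p h.symm]
  congr 2
  exact Sym2.eq_swap

theorem rigidityMatrix_apply_eq_zero {V : Type*} {d : ℕ} (G : SimpleGraph V)
    (X : Seminorm ℝ (Fin d → ℝ)) (p : V → Fin d → ℝ) {e : G.edgeSet} {v : V}
    (h : v ∉ (e : Sym2 V)) (j : Fin d) : rigidityMatrix G X p e (v, j) = 0 := by
  simp [rigidityMatrix, h]

theorem supportFunctional_normalise {d : ℕ} {x : Fin d → ℝ} (hx : x ≠ 0) {i : Fin d}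
    (hi : IsDominant x i) (y : Fin d → ℝ) :
    supportFunctional (lInfty d) (normalise (lInfty d) x) y = ‖x‖⁻¹ * x i * y i := by
  rw [((isDominant_normalise_iff hx).2 hi).supportFunctional_eq (norm_normalise hx)]
  simp [normalise]

theorem IsDominant.sign_sq {d : ℕ} {x : Fin d → ℝ} (hx : x ≠ 0) {i : Fin d}
    (hi : IsDominant x i) : (‖x‖⁻¹ * x i) ^ 2 = 1 := by
  have h : ‖x‖ ≠ 0 := norm_ne_zero_iff.2 hx
  rw [mul_pow, ← sq_abs (x i), ← norm_eq_abs_of_isMax hi.le, ← mul_pow, inv_mul_cancel₀ h, one_pow]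

/-- The finite alphabet leaves only finitely many rigidity matrices for a given `G`. -/
theorem rigidityMatrix_mem {V : Type*} {d : ℕ} (G : SimpleGraph V) (p : V → Fin d → ℝ)
    (hp : IsFramework G (lInfty d) p) (e : G.edgeSet) (vi : V × Fin d) :
    rigidityMatrix G (lInfty d) p e vi ∈ ({-1, 0, 1} : Set ℝ) := by
  obtain ⟨v, j⟩ := vi
  by_cases h : v ∈ (e : Sym2 V)
  · obtain ⟨e, he⟩ := e
    obtain ⟨w, rfl⟩ := h
    have hadj : G.Adj v w := he
    obtain ⟨hne, i, hi⟩ := (isFramework_lInfty_iff G p).1 hp v w hadj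
    rw [rigidityMatrix_apply G _ p hadj, supportFunctional_normalise (sub_ne_zero.2 hne) hi]
    have := hi.sign_sq (sub_ne_zero.2 hne)
    by_cases hij : i = j
    · subst hij
      simp only [Pi.single_eq_same, mul_one]
      rcases eq_or_eq_neg_of_sq_eq_sq (‖p v - p w‖⁻¹ * (p v - p w) i) 1 (by rw [this, one_pow])
        with h | h <;> rw [h] <;> simp
    · simp [hij]
  · simp [rigidityMatrix_apply_eq_zero G _ p h]

-- The row of an edge of colour `i` is a sign times the difference of its ends in coordinate `i`;
-- squaring removes the sign. On the right at most one summand is nonzero, as dominance is unique.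
open Classical in
theorem rigidityMatrix_mulVec_sq {V : Type*} [Fintype V] {d : ℕ} (G : SimpleGraph V)
    (p : V → Fin d → ℝ) (hp : IsFramework G (lInfty d) p) (x : V × Fin d → ℝ) {v w : V}
    (h : G.Adj v w) :
    (rigidityMatrix G (lInfty d) p *ᵥ x) ⟨s(v, w), h⟩ ^ 2 =
      ∑ i, if (colourGraph G p i).Adj v w then (x (v, i) - x (w, i)) ^ 2 else 0 := by
  obtain ⟨hne, i, hi⟩ := (isFramework_lInfty_iff G p).1 hp v w h
  have hx := sub_ne_zero.2 hne
  have hx' := sub_ne_zero.2 hne.symm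
  have hR : (rigidityMatrix G (lInfty d) p *ᵥ x) ⟨s(v, w), h⟩ =
      ‖p v - p w‖⁻¹ * (p v - p w) i * (x (v, i) - x (w, i)) := by
    rw [Matrix.mulVec, dotProduct, Fintype.sum_prod_type, Fintype.sum_eq_add v w h.ne]
    · simp only [rigidityMatrix_apply, rigidityMatrix_apply_right,
        supportFunctional_normalise hx hi, supportFunctional_normalise hx' hi.sub_comm]
      rw [norm_sub_rev (p w), Fintype.sum_eq_single i, Fintype.sum_eq_single i]
      · simp; ring
      · intro j hj; simp [hj.symm]
      · intro j hj; simp [hj.symm]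
    · intro u hu
      refine Finset.sum_eq_zero fun j _ => ?_
      rw [rigidityMatrix_apply_eq_zero _ _ _ (by simpa using hu), zero_mul]
  rw [hR, mul_pow, hi.sign_sq hx, one_mul, Fintype.sum_eq_single i]
  · rw [if_pos ⟨h, hi⟩]
  · intro j hj
    rw [if_neg fun hc => hj (hc.2.unique hi)]

open Classical in
theorem two_mul_sum_edgeSet {V : Type*} [Fintype V] (G : SimpleGraph V) (F : Sym2 V → ℝ) :
    2 * ∑ e : G.edgeSet, F e = ∑ v, ∑ w, if G.Adj v w then F s(v, w) else 0 := by
  rw [← Fintype.sum_prod_type' fun v w => if G.Adj v w then F s(v, w) else 0,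
    ← Finset.sum_filter]
  have hmaps : ∀ q ∈ Finset.univ.filter (fun q : V × V => G.Adj q.1 q.2),
      s(q.1, q.2) ∈ G.edgeFinset := fun q hq => by simpa using hq
  rw [← Finset.sum_fiberwise_of_maps_to hmaps]
  have hF : ∑ e : G.edgeSet, F e = ∑ e ∈ G.edgeFinset, F e := by
    exact (Finset.sum_subtype G.edgeFinset (fun e => by simp) F).symm
  rw [hF, Finset.mul_sum]
  refine Finset.sum_congr rfl fun e he => ?_
  induction e with | _ v w
  have hvw : G.Adj v w := by simpa using he
  have hfib : ((Finset.univ.filter (fun q : V × V => G.Adj q.1 q.2)).filter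
      fun q => s(q.1, q.2) = s(v, w)) = {(v, w), (w, v)} := by
    ext ⟨a, b⟩
    simp only [Finset.mem_filter, Finset.mem_univ, true_and, Finset.mem_insert,
      Finset.mem_singleton, Sym2.eq_iff, Prod.mk.injEq]
    constructor
    · exact fun h => h.2
    · rintro (⟨rfl, rfl⟩ | ⟨rfl, rfl⟩)
      · exact ⟨hvw, Or.inl ⟨rfl, rfl⟩⟩
      · exact ⟨hvw.symm, Or.inr ⟨rfl, rfl⟩⟩
  rw [hfib, Finset.sum_pair (by simpa using fun h => (hvw.ne h).elim)]
  simp only [Sym2.eq_swap (a := w)]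
  ring

/-- This is the block decomposition by colour. The factor 2 appears because `energy` sums over
ordered pairs. -/
theorem two_mul_dotProduct_frameworkLaplacian {V : Type*} [Fintype V] {d : ℕ} (G : SimpleGraph V)
    (p : V → Fin d → ℝ) (hp : IsFramework G (lInfty d) p) (x : V × Fin d → ℝ) :
    2 * (x ⬝ᵥ frameworkLaplacian G (lInfty d) p *ᵥ x) =
      ∑ i, energy (colourGraph G p i) (fun v => x (v, i)) := by
  classical
  set R := rigidityMatrix G (lInfty d) p with hR
  set F : Sym2 V → ℝ := fun e => if h : e ∈ G.edgeSet then (R *ᵥ x) ⟨e, h⟩ ^ 2 else 0 with hF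
  have h1 : x ⬝ᵥ frameworkLaplacian G (lInfty d) p *ᵥ x = ∑ e : G.edgeSet, F e := by
    rw [frameworkLaplacian, ← hR, ← Matrix.mulVec_mulVec, Matrix.dotProduct_mulVec,
      Matrix.vecMul_transpose, dotProduct]
    have : ∀ e : G.edgeSet, (R *ᵥ x) e * (R *ᵥ x) e = F e := fun e => by simp [hF, sq]
    simp only [this]
  rw [h1, two_mul_sum_edgeSet]
  simp only [energy]
  symm
  rw [Finset.sum_comm]
  refine Finset.sum_congr rfl fun v _ => ?_
  rw [Finset.sum_comm]
  refine Finset.sum_congr rfl fun w _ => ?_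
  split_ifs with h
  · rw [← rigidityMatrix_mulVec_sq G p hp x h]
    simp [hF, hR, h]
  · exact Finset.sum_eq_zero fun i _ => if_neg fun hc => h hc.1

/-! ### The set of rigidity eigenvalues -/

theorem finite_rigidityEigenvalues {V : Type*} [Fintype V] {d : ℕ} (G : SimpleGraph V) :
    (rigidityEigenvalues G (lInfty d)).Finite := by
  classical
  have hfin : {M : G.edgeSet → V × Fin d → ℝ | ∀ e vi, M e vi ∈ ({-1, 0, 1} : Set ℝ)}.Finite := by
    have : ({-1, 0, 1} : Set ℝ).Finite := Set.toFinite _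
    have h := Set.Finite.pi' fun _ : G.edgeSet => Set.Finite.pi' fun _ : V × Fin d => this
    exact h
  have hherm : ∀ M : Matrix G.edgeSet (V × Fin d) ℝ, (Mᵀ * M).IsHermitian := fun M => by
    rw [Matrix.IsHermitian, Matrix.conjTranspose_eq_transpose_of_trivial]
    simp [Matrix.transpose_mul]
  refine (hfin.image fun M => nthEigenvalue ((Matrix.of M)ᵀ * Matrix.of M) (hherm (Matrix.of M))
    (motionDim (lInfty d) + 1)).subset ?_
  rintro _ ⟨p, hp, rfl⟩
  refine ⟨rigidityMatrix G (lInfty d) p, fun e vi => rigidityMatrix_mem G p hp e vi, ?_⟩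
  simp only [rigidityEigenvalue, frameworkLaplacian]
  congr!

theorem nonempty_rigidityEigenvalues {V : Type*} [Fintype V] {d : ℕ} (hd : 0 < d)
    (G : SimpleGraph V) : (rigidityEigenvalues G (lInfty d)).Nonempty := by
  -- Distinct points on one coordinate axis: that coordinate dominates every difference.
  set q : V → Fin d → ℝ := fun v => Pi.single ⟨0, hd⟩ (Fintype.equivFin V v : ℝ) with hq
  refine ⟨_, q, (isFramework_lInfty_iff G q).2 fun v w h => ?_, rfl⟩
  have hne : q v ⟨0, hd⟩ ≠ q w ⟨0, hd⟩ := by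
    simpa [hq, Fin.val_inj] using h.ne
  refine ⟨fun he => hne (congrFun he _), ⟨0, hd⟩, fun j hj => ?_⟩
  have : (q v - q w) j = 0 := by simp [hq, hj]
  rw [this, abs_zero]
  exact abs_pos.2 (sub_ne_zero.2 hne)

/-! ### Upper bounds from test functions -/

/-- A test function for one colour class bounds the rigidity eigenvalue from above. -/
theorem rigidityEigenvalue_le {V : Type*} [Fintype V] {d : ℕ} (hV : 2 ≤ Fintype.card V)
    (G : SimpleGraph V) (p : V → Fin d → ℝ) (hp : IsFramework G (lInfty d) p) (i : Fin d)
    {f : V → ℝ} (hf0 : f ≠ 0) (hf : ∑ v, f v = 0) {μ : ℝ} (hμ : 0 ≤ μ)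
    (hle : energy (colourGraph G p i) f ≤ 2 * μ * ∑ v, f v ^ 2) :
    rigidityEigenvalue G (lInfty d) p ≤ μ := by
  classical
  have : Nonempty V := Fintype.card_pos_iff.1 (by omega)
  -- The test space has dimension `d + 1`: the translations, and multiples of `f` in block `i`.
  -- Since `f` sums to zero, block sums recover the translation part, which gives injectivity.
  let T : (Fin d → ℝ) × ℝ →ₗ[ℝ] (V × Fin d → ℝ) :=
    { toFun := fun a vj => a.1 vj.2 + a.2 * if vj.2 = i then f vj.1 else 0
      map_add' := fun a b => by ext; simp only [Prod.fst_add, Prod.snd_add, Pi.add_apply]; ring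
      map_smul' := fun c a => by
        ext; simp only [Prod.smul_fst, Prod.smul_snd, Pi.smul_apply, smul_eq_mul, RingHom.id_apply]
        ring }
  have hT : ∀ a vj, T a vj = a.1 vj.2 + a.2 * if vj.2 = i then f vj.1 else 0 := fun _ _ => rfl
  have hsum : ∀ a j, ∑ v, T a (v, j) = Fintype.card V * a.1 j := by
    intro a j
    simp only [hT, Finset.sum_add_distrib]
    by_cases hj : j = i
    · simp [hj, ← Finset.mul_sum, hf]
    · simp [hj]
  have hn : (Fintype.card V : ℝ) ≠ 0 := by simp
  have hinj : Function.Injective T := by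
    rw [← LinearMap.ker_eq_bot, LinearMap.ker_eq_bot']
    rintro ⟨c, b⟩ h
    have hc : c = 0 := by
      ext j
      have := hsum (c, b) j
      rw [h] at this
      simpa using this
    subst hc
    obtain ⟨v, hv⟩ := Function.ne_iff.1 hf0
    have := hT (0, b) (v, i)
    rw [h] at this
    have hb : b = 0 := by simpa [show f v ≠ 0 from hv] using this
    rw [hb, Prod.mk_zero_zero]
  rw [rigidityEigenvalue]
  have hd : 1 ≤ d := i.pos
  refine nthEigenvalue_le _ (by omega) ?_ (LinearMap.range T) ?_ ?_
  · rw [motionDim_lInfty, Fintype.card_prod, Fintype.card_fin]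
    nlinarith
  · rw [LinearMap.finrank_range_of_inj hinj, motionDim_lInfty]
    simp
  · rintro _ ⟨a, rfl⟩
    have hq := two_mul_dotProduct_frameworkLaplacian G p hp (T a)
    rw [Fintype.sum_eq_single i] at hq
    · have he : energy (colourGraph G p i) (fun v => T a (v, i)) =
          a.2 ^ 2 * energy (colourGraph G p i) f := by
        rw [← energy_smul, ← energy_add_const _ (fun v => a.2 * f v) (a.1 i)]
        congr 1
        ext v
        rw [hT, if_pos rfl, add_comm]
      -- As `f` is orthogonal to constants, the translation part only increases the norm, while it
      -- does not affect the energy.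
      have hnorm : a.2 ^ 2 * ∑ v, f v ^ 2 ≤ T a ⬝ᵥ T a := by
        have h1 : ∑ v, T a (v, i) * T a (v, i) ≤ T a ⬝ᵥ T a := by
          rw [dotProduct, Fintype.sum_prod_type_right]
          exact Finset.single_le_sum (f := fun j => ∑ v, T a (v, j) * T a (v, j))
            (fun j _ => Finset.sum_nonneg fun v _ => mul_self_nonneg _) (Finset.mem_univ i)
        have h2 : ∀ v, T a (v, i) * T a (v, i) =
            a.2 ^ 2 * f v ^ 2 + 2 * a.1 i * a.2 * f v + a.1 i ^ 2 := fun v => by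
          rw [hT, if_pos rfl]; ring
        simp only [h2, Finset.sum_add_distrib, ← Finset.mul_sum, hf] at h1
        refine le_trans ?_ h1
        rw [mul_zero, add_zero]
        exact le_add_of_nonneg_right (Finset.sum_nonneg fun _ _ => sq_nonneg _)
      rw [he] at hq
      nlinarith [mul_le_mul_of_nonneg_left hle (sq_nonneg a.2),
        mul_le_mul_of_nonneg_left hnorm hμ]
    · intro j hj
      simp [hT, hj, energy_const]

open Classical in
/-- The darts of a graph that lead out of the vertex set `A`. -/
def outDarts {V : Type*} [Fintype V] (H : SimpleGraph V) (A : Finset V) : Finset (V × V) :=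
  Finset.univ.filter fun q => H.Adj q.1 q.2 ∧ q.1 ∈ A ∧ q.2 ∉ A

open Classical in
theorem card_outDarts_eq_sum {V : Type*} [Fintype V] (H : SimpleGraph V) (A : Finset V) :
    (outDarts H A).card = ∑ v ∈ A, (H.neighborFinset v \ A).card := by
  have hmaps : ∀ q ∈ outDarts H A, q.1 ∈ A := fun q hq => by
    simp only [outDarts, Finset.mem_filter] at hq
    exact hq.2.2.1
  rw [Finset.card_eq_sum_card_fiberwise hmaps]
  refine Finset.sum_congr rfl fun v hv => ?_
  refine Finset.card_nbij' (fun q => q.2) (fun w => (v, w)) ?_ ?_ ?_ ?_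
  · rintro ⟨a, b⟩ h
    simp only [outDarts, Finset.coe_filter, Finset.mem_filter, Finset.mem_univ, true_and,
      Set.mem_ofPred_eq] at h
    obtain ⟨⟨h1, h2, h3⟩, rfl⟩ := h
    simp [h1, h3]
  · intro w h
    simp only [Finset.coe_sdiff, Set.mem_sdiff, Finset.mem_coe, SimpleGraph.mem_neighborFinset] at h
    simp [outDarts, h, hv]
  · rintro ⟨a, b⟩ h
    simp only [outDarts, Finset.coe_filter, Finset.mem_filter, Finset.mem_univ, true_and,
      Set.mem_ofPred_eq] at h
    simp [h.2]
  · intro w _; rfl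

open Classical in
theorem cast_card_outDarts {V : Type*} [Fintype V] (H : SimpleGraph V) (A : Finset V) :
    ((outDarts H A).card : ℝ) = ∑ v, ∑ w, if H.Adj v w ∧ v ∈ A ∧ w ∉ A then 1 else 0 := by
  rw [← Fintype.sum_prod_type' fun v w => if H.Adj v w ∧ v ∈ A ∧ w ∉ A then (1 : ℝ) else 0,
    outDarts, Finset.card_filter]
  push_cast
  rfl

open Classical in
theorem cast_card_outDarts' {V : Type*} [Fintype V] (H : SimpleGraph V) (A : Finset V) :
    ((outDarts H A).card : ℝ) = ∑ v, ∑ w, if H.Adj v w ∧ w ∈ A ∧ v ∉ A then 1 else 0 := by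
  rw [cast_card_outDarts, Finset.sum_comm]
  simp only [H.adj_comm]

open Classical in
/-- The energy of a combination of the indicators of two vertex sets with no edge between them. -/
theorem energy_two_sets {V : Type*} [Fintype V] (H : SimpleGraph V) {A B : Finset V}
    (hAB : ∀ v ∈ A, ∀ w ∈ B, v ≠ w ∧ ¬ H.Adj v w) (a b : ℝ) :
    energy H (fun v => if v ∈ A then b else if v ∈ B then -a else 0) =
      2 * (b ^ 2 * (outDarts H A).card + a ^ 2 * (outDarts H B).card) := by
  have hdisj : ∀ v, v ∈ A → v ∉ B := fun v hA hB => (hAB v hA v hB).1 rfl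
  have key : ∀ v w : V, (if H.Adj v w then
      ((if v ∈ A then b else if v ∈ B then -a else 0) -
        (if w ∈ A then b else if w ∈ B then -a else 0)) ^ 2 else 0) =
      b ^ 2 * (if H.Adj v w ∧ v ∈ A ∧ w ∉ A then 1 else 0) +
      b ^ 2 * (if H.Adj v w ∧ w ∈ A ∧ v ∉ A then 1 else 0) +
      (a ^ 2 * (if H.Adj v w ∧ v ∈ B ∧ w ∉ B then 1 else 0) +
      a ^ 2 * (if H.Adj v w ∧ w ∈ B ∧ v ∉ B then 1 else 0)) := by
    intro v w
    by_cases h : H.Adj v w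
    · by_cases h1 : v ∈ A
      · have h2 := hdisj v h1
        have h3 : w ∉ B := fun hw => (hAB v h1 w hw).2 h
        by_cases h4 : w ∈ A <;> simp [h, h1, h2, h3, h4]
      · by_cases h2 : w ∈ A
        · have h3 := hdisj w h2
          have h4 : v ∉ B := fun hv => (hAB w h2 v hv).2 h.symm
          simp [h, h1, h2, h3, h4]
        · by_cases h3 : v ∈ B <;> by_cases h4 : w ∈ B <;> simp [h, h1, h2, h3, h4]
    · simp [h]
  simp only [energy, key, Finset.sum_add_distrib, ← Finset.mul_sum, ← cast_card_outDarts,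
    ← cast_card_outDarts']
  ring

/-- The test function is `|B|` on `A` and `-|A|` on `B`, which has sum zero. Its Rayleigh quotient
is a weighted mean of the boundary-to-size ratios of `A` and `B`. -/
theorem rigidityEigenvalue_le_of_two_sets {V : Type*} [Fintype V] {d : ℕ} {G : SimpleGraph V}
    {p : V → Fin d → ℝ} (hp : IsFramework G (lInfty d) p) {i : Fin d} {A B : Finset V}
    (hA : A.Nonempty) (hB : B.Nonempty)
    (hAB : ∀ v ∈ A, ∀ w ∈ B, v ≠ w ∧ ¬ (colourGraph G p i).Adj v w) {μ : ℝ} (hμ : 0 ≤ μ)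
    (h : (B.card : ℝ) ^ 2 * (outDarts (colourGraph G p i) A).card +
      (A.card : ℝ) ^ 2 * (outDarts (colourGraph G p i) B).card ≤
        μ * ((B.card : ℝ) ^ 2 * A.card + (A.card : ℝ) ^ 2 * B.card)) :
    rigidityEigenvalue G (lInfty d) p ≤ μ := by
  classical
  have hdisj : Disjoint A B := Finset.disjoint_left.2 fun v hA hB => (hAB v hA v hB).1 rfl
  have hsum : ∀ a b : ℝ, ∑ v, (if v ∈ A then b else if v ∈ B then a else 0) =
      A.card * b + B.card * a := by
    intro a b
    have : ∀ v, (if v ∈ A then b else if v ∈ B then a else 0) =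
        (if v ∈ A then b else 0) + (if v ∈ B then a else 0) := by
      intro v
      by_cases h1 : v ∈ A
      · simp [h1, Finset.disjoint_left.1 hdisj h1]
      · simp [h1]
    simp [this, Finset.sum_add_distrib]
  have hcard : 2 ≤ Fintype.card V := by
    have h1 := Finset.card_le_univ (A ∪ B)
    rw [Finset.card_union_of_disjoint hdisj] at h1
    have := hA.card_pos
    have := hB.card_pos
    omega
  refine rigidityEigenvalue_le hcard G p hp i
    (f := fun v => if v ∈ A then (B.card : ℝ) else if v ∈ B then -(A.card : ℝ) else 0)
    ?_ ?_ hμ ?_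
  · obtain ⟨v, hv⟩ := hA
    refine fun h0 => hB.card_pos.ne' ?_
    have := congrFun h0 v
    simpa [hv] using this
  · rw [hsum]; ring
  · rw [energy_two_sets _ hAB]
    have : ∀ v, (if v ∈ A then (B.card : ℝ) else if v ∈ B then -(A.card : ℝ) else 0) ^ 2 =
        if v ∈ A then (B.card : ℝ) ^ 2 else if v ∈ B then (A.card : ℝ) ^ 2 else 0 := by
      intro v; split_ifs <;> simp
    simp only [this, hsum]
    linarith

theorem rigidityEigenvalue_le_one_of_two_sets {V : Type*} [Fintype V] {d : ℕ}
    {G : SimpleGraph V} {p : V → Fin d → ℝ} (hp : IsFramework G (lInfty d) p) {i : Fin d}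
    {A B : Finset V} (hA : A.Nonempty) (hB : B.Nonempty)
    (hAB : ∀ v ∈ A, ∀ w ∈ B, v ≠ w ∧ ¬ (colourGraph G p i).Adj v w)
    (hbA : (outDarts (colourGraph G p i) A).card ≤ A.card)
    (hbB : (outDarts (colourGraph G p i) B).card ≤ B.card) :
    rigidityEigenvalue G (lInfty d) p ≤ 1 := by
  refine rigidityEigenvalue_le_of_two_sets hp hA hB hAB zero_le_one ?_
  rw [one_mul]
  gcongr

theorem rigidityEigenvalue_lt_one_of_two_sets {V : Type*} [Fintype V] {d : ℕ}
    {G : SimpleGraph V} {p : V → Fin d → ℝ} (hp : IsFramework G (lInfty d) p) {i : Fin d}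
    {A B : Finset V} (hA : A.Nonempty) (hB : B.Nonempty)
    (hAB : ∀ v ∈ A, ∀ w ∈ B, v ≠ w ∧ ¬ (colourGraph G p i).Adj v w)
    (hbA : (outDarts (colourGraph G p i) A).card < A.card)
    (hbB : (outDarts (colourGraph G p i) B).card ≤ B.card) :
    rigidityEigenvalue G (lInfty d) p < 1 := by
  have hA0 : (0 : ℝ) < A.card := by exact_mod_cast hA.card_pos
  have hB0 : (0 : ℝ) < B.card := by exact_mod_cast hB.card_pos
  have hpos : 0 < (B.card : ℝ) ^ 2 * A.card + (A.card : ℝ) ^ 2 * B.card := by positivity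
  refine (rigidityEigenvalue_le_of_two_sets hp hA hB hAB
    (μ := ((B.card : ℝ) ^ 2 * (outDarts (colourGraph G p i) A).card +
      (A.card : ℝ) ^ 2 * (outDarts (colourGraph G p i) B).card) /
        ((B.card : ℝ) ^ 2 * A.card + (A.card : ℝ) ^ 2 * B.card)) (by positivity)
    (le_of_eq (div_mul_cancel₀ _ hpos.ne').symm)).trans_lt ?_
  rw [div_lt_one hpos]
  have h1 : ((outDarts (colourGraph G p i) A).card : ℝ) < A.card := by exact_mod_cast hbA
  have h2 : ((outDarts (colourGraph G p i) B).card : ℝ) ≤ B.card := by exact_mod_cast hbB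
  have h3 : (0 : ℝ) < (B.card : ℝ) ^ 2 := by positivity
  exact add_lt_add_of_lt_of_le (mul_lt_mul_of_pos_left h1 h3)
    (mul_le_mul_of_nonneg_left h2 (sq_nonneg _))

/-! ### Graphs with a vertex of degree at most one -/

open Classical in
theorem rigidityEigenvalue_lt_one_of_degree_eq_zero {V : Type*} [Fintype V] {d : ℕ}
    {G : SimpleGraph V} {p : V → Fin d → ℝ} (hp : IsFramework G (lInfty d) p) {i : Fin d}
    (hV : 2 ≤ Fintype.card V) {v : V} (hv : (colourGraph G p i).degree v = 0) :
    rigidityEigenvalue G (lInfty d) p < 1 := by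
  have hadj : ∀ w, ¬ (colourGraph G p i).Adj v w := fun w hw => by
    have := (SimpleGraph.degree_pos_iff_exists_adj _ v).2 ⟨w, hw⟩
    omega
  have hcard : (Finset.univ.erase v).card = Fintype.card V - 1 := by
    rw [Finset.card_erase_of_mem (Finset.mem_univ v), Finset.card_univ]
  have h0 : ∀ A : Finset V, A = {v} ∨ A = Finset.univ.erase v →
      (outDarts (colourGraph G p i) A).card = 0 := by
    intro A hA
    rw [Finset.card_eq_zero, outDarts, Finset.filter_eq_empty_iff]
    rintro ⟨a, b⟩ - ⟨h1, h2, h3⟩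
    rcases hA with rfl | rfl
    · rw [Finset.mem_singleton.1 h2] at h1
      exact hadj b h1
    · have : b = v := by simpa using h3
      rw [show b = v from this] at h1
      exact hadj a h1.symm
  refine rigidityEigenvalue_lt_one_of_two_sets hp (i := i) (A := {v}) (B := Finset.univ.erase v)
    (Finset.singleton_nonempty v) (Finset.card_pos.1 (by omega)) ?_ ?_ ?_
  · intro a ha b hb
    rw [Finset.mem_singleton.1 ha]
    exact ⟨(Finset.ne_of_mem_erase hb).symm, hadj b⟩
  · rw [h0 _ (Or.inl rfl)]; simp
  · rw [h0 _ (Or.inr rfl)]; simp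

open Classical in
/-- A pendant vertex whose neighbour is not joined to all other vertices. -/
theorem rigidityEigenvalue_lt_one_of_degree_eq_one {V : Type*} [Fintype V] {d : ℕ}
    {G : SimpleGraph V} {p : V → Fin d → ℝ} (hp : IsFramework G (lInfty d) p) {i : Fin d}
    {v c w : V} (hv : (colourGraph G p i).degree v = 1) (hvc : (colourGraph G p i).Adj v c)
    (hwc : w ≠ c) (hw : ¬ (colourGraph G p i).Adj c w) :
    rigidityEigenvalue G (lInfty d) p < 1 := by
  set H := colourGraph G p i with hH
  have hN : H.neighborFinset v = {c} := by
    obtain ⟨c', hc'⟩ := Finset.card_eq_one.1 hv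
    have : c ∈ H.neighborFinset v := by simpa using hvc
    rw [hc', Finset.mem_singleton] at this
    rw [hc', this]
  have hadj : ∀ b, H.Adj v b → b = c := fun b hb => by
    have : b ∈ H.neighborFinset v := by simpa using hb
    rwa [hN, Finset.mem_singleton] at this
  have hwv : w ≠ v := by rintro rfl; exact hw hvc.symm
  set B : Finset V := (Finset.univ.erase v).erase c with hB
  have hmemB : ∀ b, b ∈ B ↔ b ≠ c ∧ b ≠ v := fun b => by simp [hB]
  have hwB : w ∈ B := (hmemB w).2 ⟨hwc, hwv⟩
  have hbB : (outDarts H B).card < B.card := by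
    -- The vertex `v` sees only `c`, so every dart leaving `B` ends in `c`, one per starting vertex;
    -- `w` starts none, which makes the bound strict.
    have hsub : outDarts H B ⊆ (B.erase w).map ⟨fun b => (b, c), fun a b h => by simpa using h⟩ := by
      rintro ⟨a, b⟩ h
      simp only [outDarts, Finset.mem_filter, Finset.mem_univ, true_and] at h
      obtain ⟨h1, h2, h3⟩ := h
      rw [hmemB] at h2
      have hbc : b = c := by
        by_contra hb
        have hbv : b = v := by
          by_contra hbv
          exact h3 ((hmemB b).2 ⟨hb, hbv⟩)
        subst hbv
        exact h2.1 (hadj a h1.symm)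
      subst hbc
      exact Finset.mem_map.2 ⟨a, Finset.mem_erase.2
        ⟨fun haw => hw (haw ▸ h1.symm), (hmemB a).2 h2⟩, rfl⟩
    refine (Finset.card_le_card hsub).trans_lt ?_
    rw [Finset.card_map]
    exact Finset.card_erase_lt_of_mem hwB
  refine rigidityEigenvalue_lt_one_of_two_sets hp (i := i) (A := B) (B := {v})
    ⟨w, hwB⟩ (Finset.singleton_nonempty v) ?_ hbB ?_
  · intro a ha b hb
    rw [Finset.mem_singleton.1 hb]
    exact ⟨((hmemB a).1 ha).2, fun h => ((hmemB a).1 ha).1 (hadj a h.symm)⟩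
  · rw [card_outDarts_eq_sum, Finset.sum_singleton, Finset.card_singleton, ← hv]
    exact Finset.card_le_card Finset.sdiff_subset

/-! ### Two-regular graphs -/

open Classical in
/-- In a two-regular graph, there is an edge away from any small set with small boundary. -/
theorem exists_adj_away {V : Type*} [Fintype V] {H : SimpleGraph V} (hH : ∀ v, H.degree v = 2)
    {A : Finset V} (hA : (outDarts H A).card ≤ 2) (hV : A.card + 4 ≤ Fintype.card V) :
    ∃ x y, H.Adj x y ∧ x ∉ A ∧ y ∉ A ∧ ∀ a ∈ A, ¬ H.Adj a x ∧ ¬ H.Adj a y := by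
  set T : Finset V := (outDarts H A).image Prod.snd with hT
  have hTmem : ∀ t, t ∈ T ↔ t ∉ A ∧ ∃ a ∈ A, H.Adj a t := by
    intro t
    simp only [hT, outDarts, Finset.mem_image, Finset.mem_filter, Finset.mem_univ, true_and,
      Prod.exists, exists_eq_right]
    constructor
    · rintro ⟨a, h1, h2, h3⟩; exact ⟨h3, a, h2, h1⟩
    · rintro ⟨h3, a, h2, h1⟩; exact ⟨a, h1, h2, h3⟩
  -- `T` is the outer vertex boundary of `A`. An edge avoiding `A ∪ T` is what is wanted.
  have hTcard : T.card ≤ 2 := Finset.card_image_le.trans hA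
  set S : Finset V := A ∪ T with hS
  have hSmem : ∀ x, x ∉ S → x ∉ A ∧ ∀ a ∈ A, ¬ H.Adj a x := by
    intro x hx
    rw [hS, Finset.mem_union, not_or, hTmem] at hx
    exact ⟨hx.1, fun a ha h => hx.2 ⟨hx.1, a, ha, h⟩⟩
  by_contra! hcon
  -- Without such an edge, both neighbours of each vertex outside `S` lie in `T`.
  have hout : ∀ x ∈ Sᶜ, (T.filter (H.Adj x)).card = 2 := by
    intro x hx
    have hx := hSmem x (Finset.mem_compl.1 hx)
    rw [← hH x]
    refine congrArg Finset.card ?_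
    ext y
    simp only [Finset.mem_filter, SimpleGraph.mem_neighborFinset, and_iff_right_iff_imp]
    intro hxy
    by_contra hy
    have hyA : y ∉ A := fun hyA => hx.2 y hyA hxy.symm
    have hyS := hSmem y (by simp [hS, hyA, hy])
    obtain ⟨a, ha, h⟩ := hcon x y hxy hx.1 hyA
    exact hyS.2 a ha (h (hx.2 a ha))
  -- One of the two edges at `t` goes back to `A`. Double counting then gives `2|Sᶜ| ≤ |T| ≤ 2`,
  -- whereas `|Sᶜ| ≥ 2`.
  have hin : ∀ t ∈ T, (Sᶜ.filter (H.Adj · t)).card ≤ 1 := by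
    intro t ht
    obtain ⟨-, a, ha, hat⟩ := (hTmem t).1 ht
    have hsub : Sᶜ.filter (H.Adj · t) ⊆ (H.neighborFinset t).erase a := by
      intro x hx
      simp only [Finset.mem_filter, Finset.mem_compl] at hx
      simp only [Finset.mem_erase, SimpleGraph.mem_neighborFinset]
      refine ⟨?_, hx.2.symm⟩
      rintro rfl
      exact (hSmem _ hx.1).1 ha
    refine (Finset.card_le_card hsub).trans ?_
    rw [Finset.card_erase_of_mem (by simpa using hat.symm), SimpleGraph.card_neighborFinset_eq_degree,
      hH]
  have hdc := Finset.sum_card_bipartiteAbove_eq_sum_card_bipartiteBelow (s := Sᶜ) (t := T) H.Adj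
  have h1 : ∑ x ∈ Sᶜ, (Finset.bipartiteAbove H.Adj T x).card = Sᶜ.card * 2 :=
    Finset.sum_const_nat hout
  have h2 : ∑ t ∈ T, (Finset.bipartiteBelow H.Adj Sᶜ t).card ≤ T.card * 1 :=
    Finset.sum_le_card_nsmul _ _ _ hin
  have h3 : S.card ≤ A.card + T.card := Finset.card_union_le A T
  have h4 := Finset.card_compl_add_card S
  omega

open Classical in
theorem card_outDarts_pair_le {V : Type*} [Fintype V] {H : SimpleGraph V}
    (hH : ∀ v, H.degree v = 2) {x y : V} (hxy : H.Adj x y) :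
    (outDarts H {x, y}).card ≤ 2 := by
  have key : ∀ {x y : V}, H.Adj x y → (H.neighborFinset x \ {x, y}).card ≤ 1 := by
    intro x y hxy
    have hsub : H.neighborFinset x \ {x, y} ⊆ (H.neighborFinset x).erase y := by
      intro z hz
      simp only [Finset.mem_sdiff, Finset.mem_insert, Finset.mem_singleton, not_or] at hz
      exact Finset.mem_erase.2 ⟨hz.2.2, hz.1⟩
    refine (Finset.card_le_card hsub).trans ?_
    rw [Finset.card_erase_of_mem (by simpa using hxy), SimpleGraph.card_neighborFinset_eq_degree,
      hH]
  rw [card_outDarts_eq_sum, Finset.sum_pair hxy.ne]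
  have h1 := key hxy
  have h2 := key hxy.symm
  rw [Finset.pair_comm y x] at h2
  omega

-- Two edges at distance at least two each have boundary at most 2, equal to their number of
-- vertices. Six is `2 + 4`, the room `exists_adj_away` needs.
open Classical in
theorem rigidityEigenvalue_le_one_of_two_regular {V : Type*} [Fintype V] {d : ℕ}
    {G : SimpleGraph V} {p : V → Fin d → ℝ} (hp : IsFramework G (lInfty d) p) {i : Fin d}
    (hH : ∀ v, (colourGraph G p i).degree v = 2) (hV : 6 ≤ Fintype.card V) :
    rigidityEigenvalue G (lInfty d) p ≤ 1 := by
  obtain ⟨u⟩ : Nonempty V := Fintype.card_pos_iff.1 (by omega)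
  obtain ⟨v, huv⟩ := (SimpleGraph.degree_pos_iff_exists_adj _ u).1 (by rw [hH]; norm_num)
  have hb := card_outDarts_pair_le hH huv
  have hc := Finset.card_pair huv.ne
  obtain ⟨x, y, hxy, hx, hy, h⟩ := exists_adj_away hH hb (by omega)
  have hc' := Finset.card_pair hxy.ne
  refine rigidityEigenvalue_le_one_of_two_sets hp (i := i) (A := {u, v}) (B := {x, y})
    (by simp) (by simp) ?_ (by omega) (by have := card_outDarts_pair_le hH hxy; omega)
  intro a ha b hb
  rcases Finset.mem_insert.1 hb with rfl | hb
  · exact ⟨by rintro rfl; exact hx ha, (h a ha).1⟩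
  · rw [Finset.mem_singleton.1 hb]
    exact ⟨by rintro rfl; exact hy ha, (h a ha).2⟩

-- A vertex with its two neighbours has boundary at most 2 but size 3, and this makes the bound
-- strict. A distant edge then needs `3 + 4` vertices.
open Classical in
theorem rigidityEigenvalue_lt_one_of_two_regular {V : Type*} [Fintype V] {d : ℕ}
    {G : SimpleGraph V} {p : V → Fin d → ℝ} (hp : IsFramework G (lInfty d) p) {i : Fin d}
    (hH : ∀ v, (colourGraph G p i).degree v = 2) (hV : 7 ≤ Fintype.card V) :
    rigidityEigenvalue G (lInfty d) p < 1 := by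
  set H := colourGraph G p i with hHdef
  obtain ⟨v⟩ : Nonempty V := Fintype.card_pos_iff.1 (by omega)
  obtain ⟨u, w, huw, hN⟩ := Finset.card_eq_two.1 (hH v)
  have hvu : H.Adj v u := by
    rw [← SimpleGraph.mem_neighborFinset, hN]; simp
  have hvw : H.Adj v w := by
    rw [← SimpleGraph.mem_neighborFinset, hN]; simp
  have key : ∀ a, H.Adj v a → (H.neighborFinset a \ {v, u, w}).card ≤ 1 := by
    intro a hva
    have hsub : H.neighborFinset a \ {v, u, w} ⊆ (H.neighborFinset a).erase v := by
      intro z hz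
      simp only [Finset.mem_sdiff, Finset.mem_insert, Finset.mem_singleton, not_or] at hz
      exact Finset.mem_erase.2 ⟨hz.2.1, hz.1⟩
    refine (Finset.card_le_card hsub).trans ?_
    rw [Finset.card_erase_of_mem (by simpa using hva.symm),
      SimpleGraph.card_neighborFinset_eq_degree, hH]
  have hc : ({v, u, w} : Finset V).card = 3 :=
    Finset.card_eq_three.2 ⟨v, u, w, hvu.ne, hvw.ne, huw, rfl⟩
  have hb : (outDarts H {v, u, w}).card ≤ 2 := by
    rw [card_outDarts_eq_sum, Finset.sum_insert (by simp [hvu.ne, hvw.ne]), Finset.sum_pair huw]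
    have h0 : (H.neighborFinset v \ {v, u, w}).card = 0 := by
      rw [Finset.card_eq_zero, Finset.sdiff_eq_empty_iff_subset, hN]
      exact Finset.subset_insert _ _
    have h1 := key u hvu
    have h2 := key w hvw
    omega
  obtain ⟨x, y, hxy, hx, hy, h⟩ := exists_adj_away hH hb (by omega)
  have hc' := Finset.card_pair hxy.ne
  refine rigidityEigenvalue_lt_one_of_two_sets hp (i := i) (A := {v, u, w}) (B := {x, y})
    (by simp) (by simp) ?_ (by rw [← hHdef, hc]; omega)
    (by rw [← hHdef, hc']; exact card_outDarts_pair_le hH hxy)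
  intro a ha b hb
  rcases Finset.mem_insert.1 hb with rfl | hb
  · exact ⟨by rintro rfl; exact hx ha, (h a ha).1⟩
  · rw [Finset.mem_singleton.1 hb]
    exact ⟨by rintro rfl; exact hy ha, (h a ha).2⟩

/-! ### Counting edges by colour -/

open Classical in
theorem sum_degree_colourGraph_le {V : Type*} [Fintype V] {d : ℕ} (G : SimpleGraph V)
    (p : V → Fin d → ℝ) (v : V) : ∑ i, (colourGraph G p i).degree v ≤ G.degree v := by
  simp only [← SimpleGraph.card_neighborFinset_eq_degree]
  rw [← Finset.card_biUnion]
  · refine Finset.card_le_card fun w hw => ?_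
    simp only [Finset.mem_biUnion, SimpleGraph.mem_neighborFinset] at hw
    obtain ⟨i, -, hi⟩ := hw
    simpa using hi.1
  · intro i _ j _ hij
    refine Finset.disjoint_left.2 fun w hi hj => hij ?_
    rw [SimpleGraph.mem_neighborFinset] at hi hj
    exact hi.2.unique hj.2

-- Summing `2d ≤ ∑ᵢ degᵢ v ≤ deg v` over all vertices gives `2d|V| ≤ 2|E| ≤ 2d|V|`, so every
-- inequality is an equality.
open Classical in
theorem degree_eq_of_two_le {V : Type*} [Fintype V] {d : ℕ} (G : SimpleGraph V)
    (p : V → Fin d → ℝ) (hE : G.edgeSet.ncard ≤ d * Fintype.card V)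
    (h : ∀ i v, 2 ≤ (colourGraph G p i).degree v) :
    (∀ v, G.degree v = 2 * d) ∧ ∀ i v, (colourGraph G p i).degree v = 2 := by
  have h1 : ∀ v, d * 2 ≤ ∑ i, (colourGraph G p i).degree v := fun v => by
    have := Finset.card_nsmul_le_sum Finset.univ (fun i => (colourGraph G p i).degree v) 2
      fun i _ => h i v
    simpa using this
  have h2 := sum_degree_colourGraph_le G p
  have hsum := G.sum_degrees_eq_twice_card_edges
  have hcard : G.edgeSet.ncard = G.edgeFinset.card := by
    rw [← SimpleGraph.coe_edgeFinset, Set.ncard_coe_finset]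
  rw [← hcard] at hsum
  have hG : ∀ v, G.degree v = d * 2 := by
    have hle : ∀ v ∈ Finset.univ, d * 2 ≤ G.degree v := fun v _ => (h1 v).trans (h2 v)
    have heq : ∑ _v : V, d * 2 = ∑ v, G.degree v := by
      refine le_antisymm (Finset.sum_le_sum hle) ?_
      rw [hsum, Finset.sum_const, Finset.card_univ, smul_eq_mul]
      nlinarith
    exact fun v => ((Finset.sum_eq_sum_iff_of_le hle).1 heq v (Finset.mem_univ v)).symm
  refine ⟨fun v => by rw [hG, mul_comm], fun i v => ?_⟩
  have heq : ∑ _i : Fin d, 2 = ∑ i, (colourGraph G p i).degree v := by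
    refine le_antisymm (Finset.sum_le_sum fun i _ => h i v) ?_
    have := h2 v
    rw [hG] at this
    simpa using this
  exact ((Finset.sum_eq_sum_iff_of_le fun i _ => h i v).1 heq i (Finset.mem_univ i)).symm

/-! ### Excluding five vertices -/

theorem IsDominant.add {d : ℕ} {x y : Fin d → ℝ} {i : Fin d} (hx : IsDominant x i)
    (hy : IsDominant y i) (hxy : 0 ≤ x i * y i) : IsDominant (x + y) i := by
  intro j hj
  have h : |(x + y) i| = |x i| + |y i| := by
    rw [Pi.add_apply]
    exact (abs_add_eq_add_abs_iff _ _).2 (mul_nonneg_iff.1 hxy)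
  rw [h]
  exact (abs_add_le _ _).trans_lt (add_lt_add (hx j hj) (hy j hj))

open Classical in
/-- The complete graph on five vertices has no framework with a two-regular colour class: such a
class is transitively oriented by its coordinate. -/
theorem not_two_regular_of_card_eq_five {V : Type*} [Fintype V] {d : ℕ} (hd : 2 ≤ d)
    {G : SimpleGraph V} (p : V → Fin d → ℝ) (hV : Fintype.card V = 5)
    (hG : ∀ v w, v ≠ w → G.Adj v w) (i : Fin d) :
    ¬ ∀ v, (colourGraph G p i).degree v = 2 := by
  intro hH
  set H := colourGraph G p i with hHdef
  obtain ⟨j, hj⟩ : ∃ j : Fin d, j ≠ i := by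
    have : Nontrivial (Fin d) := Fin.nontrivial_iff_two_le.2 hd
    exact exists_ne i
  -- A second coordinate makes dominance a nonvacuous strict inequality, so the dominant difference
  -- is nonzero and every edge is oriented.
  have hne : ∀ {v w}, H.Adj v w → p v i ≠ p w i := fun h he => by
    have := h.2 j hj
    rw [Pi.sub_apply _ _ i, he, sub_self, abs_zero] at this
    exact (abs_nonneg _).not_gt this
  have htrans : ∀ {u v w}, H.Adj u v → H.Adj v w → p u i < p v i → p v i < p w i → H.Adj u w := by
    intro u v w huv hvw h1 h2
    refine ⟨hG u w (by rintro rfl; exact lt_asymm h1 h2), ?_⟩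
    have := huv.2.add hvw.2 (by
      simp only [Pi.sub_apply]
      exact mul_nonneg_of_nonpos_of_nonpos (by linarith) (by linarith))
    rwa [sub_add_sub_cancel] at this
  have hN : ∀ {a b c}, H.Adj a b → H.Adj a c → b ≠ c → ∀ x, H.Adj a x → x = b ∨ x = c := by
    intro a b c hab hac hbc x hax
    by_contra! hx
    have hsub : ({x, b, c} : Finset V) ⊆ H.neighborFinset a := by
      intro y hy
      simp only [Finset.mem_insert, Finset.mem_singleton] at hy
      rcases hy with rfl | rfl | rfl <;> simpa
    have h1 := Finset.card_le_card hsub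
    rw [SimpleGraph.card_neighborFinset_eq_degree, hH,
      Finset.card_eq_three.2 ⟨x, b, c, hx.1, hx.2, hbc, rfl⟩] at h1
    omega
  -- By transitivity a monotone path closes to a triangle, which is then a whole component. A fourth
  -- vertex `x` would need two neighbours, but only one other vertex remains.
  have hpath : ∀ {u v w}, H.Adj u v → H.Adj v w → p u i < p v i → ¬ p v i < p w i := by
    intro u v w huv hvw h1 h2
    have huw := htrans huv hvw h1 h2
    obtain ⟨x, hx⟩ : ∃ x, x ∉ ({u, v, w} : Finset V) := by
      by_contra! hall
      have h3 := Finset.card_le_card (fun x _ => hall x : Finset.univ ⊆ ({u, v, w} : Finset V))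
      rw [Finset.card_univ, hV] at h3
      have := Finset.card_le_three (a := u) (b := v) (c := w)
      omega
    simp only [Finset.mem_insert, Finset.mem_singleton, not_or] at hx
    have hdisj : Disjoint (H.neighborFinset x) {u, v, w, x} := by
      refine Finset.disjoint_left.2 fun y hy hy' => ?_
      rw [SimpleGraph.mem_neighborFinset] at hy
      simp only [Finset.mem_insert, Finset.mem_singleton] at hy'
      rcases hy' with rfl | rfl | rfl | rfl
      · rcases hN huv huw hvw.ne x hy.symm with h | h
        · exact hx.2.1 h
        · exact hx.2.2 h
      · rcases hN huv.symm hvw huw.ne x hy.symm with h | h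
        · exact hx.1 h
        · exact hx.2.2 h
      · rcases hN huw.symm hvw.symm huv.ne x hy.symm with h | h
        · exact hx.1 h
        · exact hx.2.1 h
      · exact H.loopless.irrefl _ hy
    have h3 := Finset.card_le_univ (H.neighborFinset x ∪ {u, v, w, x})
    have h4 : ({u, v, w, x} : Finset V).card = 4 := by
      rw [Finset.card_insert_of_notMem (by simp [huv.ne, huw.ne, Ne.symm hx.1]),
        Finset.card_eq_three.2 ⟨v, w, x, hvw.ne, Ne.symm hx.2.1, Ne.symm hx.2.2, rfl⟩]
    rw [Finset.card_union_of_disjoint hdisj, SimpleGraph.card_neighborFinset_eq_degree, hH, h4,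
      hV] at h3
    omega
  -- Without monotone paths every vertex is a source or a sink. The class is then bipartite and
  -- regular, with two parts of equal size, which is impossible for five vertices.
  set S : Finset V := Finset.univ.filter fun v => ∃ w, H.Adj v w ∧ p v i < p w i with hS
  have hbip : H.IsBipartiteWith (S : Set V) ((Sᶜ : Finset V) : Set V) := by
    refine ⟨by rw [Finset.coe_compl]; exact disjoint_compl_right, fun v w hvw => ?_⟩
    have key : ∀ {v w}, H.Adj v w → p v i < p w i → v ∈ S ∧ w ∈ Sᶜ := by
      intro v w hvw hlt
      refine ⟨by simpa [hS] using ⟨w, hvw, hlt⟩, ?_⟩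
      rw [Finset.mem_compl]
      intro hw
      obtain ⟨x, hwx, hlt'⟩ : ∃ x, H.Adj w x ∧ p w i < p x i := by simpa [hS] using hw
      exact hpath hvw hwx hlt hlt'
    rcases lt_or_gt_of_ne (hne hvw) with h | h
    · exact Or.inl (key hvw h)
    · exact Or.inr (key hvw.symm h).symm
  have hsum := SimpleGraph.isBipartiteWith_sum_degrees_eq hbip
  simp only [hH, Finset.sum_const, smul_eq_mul] at hsum
  have := Finset.card_add_card_compl S
  omega

/-! ### Case distinction and recognition of the octahedron -/

open Classical in
/-- The rigidity eigenvalue is less than `1` unless the graph is four-regular on six vertices. -/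
theorem rigidityEigenvalue_lt_one_or {V : Type*} [Fintype V] {d : ℕ} (hd : 2 ≤ d)
    (G : SimpleGraph V) (hV : d + 1 ≤ Fintype.card V)
    (hE : G.edgeSet.ncard ≤ d * Fintype.card V) {p : V → Fin d → ℝ}
    (hp : IsFramework G (lInfty d) p) :
    rigidityEigenvalue G (lInfty d) p < 1 ∨ (rigidityEigenvalue G (lInfty d) p ≤ 1 ∧ d = 2 ∧
      Fintype.card V = 6 ∧ ∀ v, G.degree v = 4) := by
  by_cases h0 : ∃ i v, (colourGraph G p i).degree v = 0
  · obtain ⟨i, v, h⟩ := h0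
    exact Or.inl (rigidityEigenvalue_lt_one_of_degree_eq_zero hp (by omega) h)
  push Not at h0
  by_cases h1 : ∃ i v, (colourGraph G p i).degree v = 1
  · obtain ⟨i, v, h⟩ := h1
    obtain ⟨c, hc⟩ := (SimpleGraph.degree_pos_iff_exists_adj _ v).1 (by rw [h]; norm_num)
    obtain ⟨j, hj⟩ : ∃ j : Fin d, j ≠ i := by
      have : Nontrivial (Fin d) := Fin.nontrivial_iff_two_le.2 hd
      exact exists_ne i
    -- The neighbour `c` of the pendant vertex has an edge `cw` of another colour `j`, so `w` is not
    -- joined to `c` in colour `i`.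
    obtain ⟨w, hw⟩ := (SimpleGraph.degree_pos_iff_exists_adj _ c).1 (Nat.pos_of_ne_zero (h0 j c))
    exact Or.inl (rigidityEigenvalue_lt_one_of_degree_eq_one hp h hc hw.ne.symm
      fun h' => hj (hw.2.unique h'.2))
  push Not at h1
  obtain ⟨hG, hH⟩ := degree_eq_of_two_le G p hE fun i v => by
    have := h0 i v
    have := h1 i v
    omega
  have : Nonempty V := Fintype.card_pos_iff.1 (by omega)
  -- Regularity of degree `2d` gives `2d < |V|`, so at most six vertices forces `d = 2`.
  have hlt := G.degree_lt_card_verts (Classical.arbitrary V)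
  rw [hG] at hlt
  set i : Fin d := ⟨0, by omega⟩
  rcases Nat.lt_or_ge (Fintype.card V) 6 with h6 | h6
  · exfalso
    have hd2 : d = 2 := by omega
    refine not_two_regular_of_card_eq_five hd p (by omega) (fun v w hvw => ?_) i (hH i)
    have hsub : G.neighborFinset v ⊆ Finset.univ.erase v := fun x hx => by
      simp only [SimpleGraph.mem_neighborFinset] at hx
      simpa using hx.ne.symm
    have heq := Finset.eq_of_subset_of_card_le hsub (by
      rw [Finset.card_erase_of_mem (Finset.mem_univ v), Finset.card_univ,
        SimpleGraph.card_neighborFinset_eq_degree, hG]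
      omega)
    rw [← SimpleGraph.mem_neighborFinset, heq]
    simpa using hvw.symm
  · rcases Nat.lt_or_ge (Fintype.card V) 7 with h7 | h7
    · have hd2 : d = 2 := by omega
      exact Or.inr ⟨rigidityEigenvalue_le_one_of_two_regular hp (hH i) h6, hd2, by omega,
        fun v => by rw [hG, hd2]⟩
    · exact Or.inl (rigidityEigenvalue_lt_one_of_two_regular hp (hH i) h7)

-- The complement is 1-regular, hence a perfect matching given by a fixed-point-free involution `m`.
-- Its three pairs are the parts of `K_{2,2,2}`.
open Classical in
theorem nonempty_iso_octahedralGraph {V : Type*} [Fintype V] (G : SimpleGraph V)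
    (hV : Fintype.card V = 6) (hG : ∀ v, G.degree v = 4) : Nonempty (G ≃g octahedralGraph) := by
  have hcompl : ∀ v, (Gᶜ).degree v = 1 := fun v => by
    rw [SimpleGraph.degree_compl, hV, hG]
  have hex : ∀ v, ∃ w, w ≠ v ∧ ¬ G.Adj v w := fun v => by
    obtain ⟨w, hw⟩ := (SimpleGraph.degree_pos_iff_exists_adj _ v).1
      (by rw [hcompl v]; exact one_pos)
    exact ⟨w, hw.ne.symm, ((SimpleGraph.compl_adj G v w).1 hw).2⟩
  have huniq : ∀ v w w', w ≠ v → w' ≠ v → ¬ G.Adj v w → ¬ G.Adj v w' → w = w' := by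
    intro v w w' h1 h2 h3 h4
    have hc : (Gᶜ.neighborFinset v).card ≤ 1 := (hcompl v).le
    exact Finset.card_le_one.1 hc w (by simp [h1.symm, h3]) w' (by simp [h2.symm, h4])
  have hout : ∀ s : Finset V, s.card ≤ 4 → ∃ x, x ∉ s := fun s hs => by
    by_contra! hall
    have := Finset.card_le_card (fun x _ => hall x : Finset.univ ⊆ s)
    rw [Finset.card_univ] at this
    omega
  choose m hm hmadj using hex
  have hadj : ∀ v w, G.Adj v w ↔ w ≠ v ∧ w ≠ m v := by
    intro v w
    refine ⟨fun h => ⟨h.ne.symm, fun he => hmadj v (he ▸ h)⟩, fun h => ?_⟩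
    by_contra hvw
    exact h.2 (huniq v w (m v) h.1 (hm v) hvw (hmadj v))
  have hmm : ∀ v, m (m v) = v := fun v =>
    huniq (m v) _ _ (hm _) (hm v).symm (hmadj _) fun h => hmadj v h.symm
  obtain ⟨a⟩ : Nonempty V := Fintype.card_pos_iff.1 (by omega)
  obtain ⟨b, hb⟩ := hout {a, m a} (Finset.card_le_two.trans (by norm_num))
  obtain ⟨c, hc⟩ := hout {a, m a, b, m b} Finset.card_le_four
  simp only [Finset.mem_insert, Finset.mem_singleton, not_or] at hb hc
  have h1 : m b ≠ a := fun h => hb.2 (by rw [← h, hmm])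
  have h2 : m b ≠ m a := fun h => hb.1 (by rw [← hmm b, h, hmm])
  have h3 : m c ≠ a := fun h => hc.2.1 (by rw [← h, hmm])
  have h4 : m c ≠ m a := fun h => hc.1 (by rw [← hmm c, h, hmm])
  have h5 : m c ≠ b := fun h => hc.2.2.2 (by rw [← h, hmm])
  have h6 : m c ≠ m b := fun h => hc.2.2.1 (by rw [← hmm c, h, hmm])
  let f : (Σ _ : Fin 3, Fin 2) → V := fun x => ![![a, m a], ![b, m b], ![c, m c]] x.1 x.2
  have hf : ∀ x y, G.Adj (f x) (f y) ↔ x.1 ≠ y.1 := by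
    rintro ⟨i, k⟩ ⟨j, l⟩
    fin_cases i <;> fin_cases j <;> fin_cases k <;> fin_cases l <;>
      simp [f, hadj, hmm, hm, h1, h2, h3, h4, h5, h6, hb, hc, Ne.symm h1, Ne.symm h2, Ne.symm h3,
        Ne.symm h4, Ne.symm h5, Ne.symm h6, Ne.symm hb.1, Ne.symm hb.2, Ne.symm hc.1,
        Ne.symm hc.2.1, Ne.symm hc.2.2.1, Ne.symm hc.2.2.2]
  have hinj : Function.Injective f := by
    rintro ⟨i, k⟩ ⟨j, l⟩ h
    have hij : i = j := by
      by_contra hne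
      exact ((hf ⟨i, k⟩ ⟨j, l⟩).2 hne).ne h
    subst hij
    have hkl : k = l := by
      fin_cases i <;> fin_cases k <;> fin_cases l <;>
        first
          | rfl
          | exact absurd h (by simp [f, hm, Ne.symm (hm _)])
    rw [hkl]
  have hbij : Function.Bijective f :=
    (Fintype.bijective_iff_injective_and_card f).2 ⟨hinj, by simp [hV]⟩
  refine ⟨SimpleGraph.Iso.symm ⟨Equiv.ofBijective f hbij, ?_⟩⟩
  intro x y
  exact hf x y

/-! ### The octahedron attains the value 1 -/

theorem two_mul_sum_sq_le_energy_of_iso_cycleGraph {V : Type*} [Fintype V] {H : SimpleGraph V}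
    (g : Fin 6 ≃ V) (hg : ∀ a b, H.Adj (g a) (g b) ↔ (SimpleGraph.cycleGraph 6).Adj a b)
    {f : V → ℝ} (hf : ∑ v, f v = 0) : 2 * ∑ v, f v ^ 2 ≤ energy H f := by
  classical
  have he : energy H f = ∑ a, ∑ b, if (SimpleGraph.cycleGraph 6).Adj a b
      then (f (g a) - f (g b)) ^ 2 else 0 := by
    rw [energy, ← g.sum_comp]
    refine Finset.sum_congr rfl fun a _ => ?_
    rw [← g.sum_comp]
    refine Finset.sum_congr rfl fun b _ => ?_
    simp only [hg]
  have hrow : ∀ (a s t : Fin 6), s ≠ t →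
      (∀ b, (SimpleGraph.cycleGraph 6).Adj a b ↔ b = s ∨ b = t) → ∀ h : Fin 6 → ℝ,
      (∑ b, if (SimpleGraph.cycleGraph 6).Adj a b then h b else 0) = h s + h t := by
    intro a s t hst hadj h
    rw [Fintype.sum_eq_add s t hst]
    · simp [hadj]
    · rintro x ⟨h1, h2⟩
      simp [hadj, h1, h2]
  rw [← g.sum_comp] at hf
  rw [he, ← g.sum_comp, Fin.sum_univ_six, Fin.sum_univ_six,
    hrow 0 1 5 (by decide) (by decide), hrow 1 0 2 (by decide) (by decide),
    hrow 2 1 3 (by decide) (by decide), hrow 3 2 4 (by decide) (by decide),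
    hrow 4 3 5 (by decide) (by decide), hrow 5 4 0 (by decide) (by decide)]
  rw [Fin.sum_univ_six] at hf
  generalize f (g 0) = x0 at *
  generalize f (g 1) = x1 at *
  generalize f (g 2) = x2 at *
  generalize f (g 3) = x3 at *
  generalize f (g 4) = x4 at *
  generalize f (g 5) = x5 at *
  have hs : (x0 + x1 + x2 + x3 + x4 + x5) ^ 2 = 0 := by rw [hf, sq, zero_mul]
  -- A sum-of-squares certificate: all four squares vanish on the eigenspace of the hexagon for
  -- eigenvalue 1, where antipodal values are opposite and the alternating sum is zero.
  linarith [sq_nonneg (x0 + x3), sq_nonneg (x1 + x4), sq_nonneg (x2 + x5),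
    sq_nonneg (x0 - x1 + x2 - x3 + x4 - x5)]

/-- Positions of the vertices of the octahedron in the plane for which each of the two colour
classes is a hexagon. -/
def octahedronPlacement : (Σ _ : Fin 3, Fin 2) → Fin 2 → ℤ :=
  fun x => ![![![5, 3], ![1, 3]], ![![3, 0], ![3, 3]], ![![1, 0], ![5, 0]]] x.1 x.2

/-- The hexagon formed by the edges of each colour. -/
def octahedronHexagon (i : Fin 2) : Fin 6 → (Σ _ : Fin 3, Fin 2) :=
  ![![⟨0, 0⟩, ⟨1, 1⟩, ⟨0, 1⟩, ⟨2, 1⟩, ⟨1, 0⟩, ⟨2, 0⟩],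
    ![⟨0, 0⟩, ⟨1, 0⟩, ⟨0, 1⟩, ⟨2, 0⟩, ⟨1, 1⟩, ⟨2, 1⟩]] i

theorem octahedronHexagon_injective : ∀ i, Function.Injective (octahedronHexagon i) := by
  decide

theorem octahedronPlacement_dominant : ∀ x y : (Σ _ : Fin 3, Fin 2), x.1 ≠ y.1 →
    ∃ i, ∀ j, j ≠ i → (octahedronPlacement x j - octahedronPlacement y j).natAbs <
      (octahedronPlacement x i - octahedronPlacement y i).natAbs := by
  decide

set_option maxRecDepth 4000 in
theorem octahedronHexagon_adj : ∀ (i : Fin 2) (a b : Fin 6),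
    ((octahedronHexagon i a).1 ≠ (octahedronHexagon i b).1 ∧ ∀ j, j ≠ i →
      (octahedronPlacement (octahedronHexagon i a) j -
        octahedronPlacement (octahedronHexagon i b) j).natAbs <
      (octahedronPlacement (octahedronHexagon i a) i -
        octahedronPlacement (octahedronHexagon i b) i).natAbs) ↔
    (SimpleGraph.cycleGraph 6).Adj a b := by
  decide

/-- Integer positions reduce dominance to statements settled by `decide`. -/
theorem isDominant_intCast_iff {d : ℕ} (x y : Fin d → ℤ) (i : Fin d) :
    IsDominant ((fun j => (x j : ℝ)) - fun j => (y j : ℝ)) i ↔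
      ∀ j, j ≠ i → (x j - y j).natAbs < (x i - y i).natAbs := by
  refine forall₂_congr fun j _ => ?_
  simp only [Pi.sub_apply]
  rw [← Int.cast_sub, ← Int.cast_sub, ← Int.cast_abs, ← Int.cast_abs, Int.cast_lt,
    Int.abs_eq_natAbs, Int.abs_eq_natAbs, Int.ofNat_lt]

/-- If every colour class satisfies a Poincaré inequality, the rigidity eigenvalue is bounded
below. -/
theorem le_rigidityEigenvalue {V : Type*} [Fintype V] {d : ℕ} (hd : 1 ≤ d)
    (hV : 2 ≤ Fintype.card V) (G : SimpleGraph V) (p : V → Fin d → ℝ)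
    (hp : IsFramework G (lInfty d) p) {μ : ℝ}
    (h : ∀ i (f : V → ℝ), ∑ v, f v = 0 → 2 * μ * ∑ v, f v ^ 2 ≤ energy (colourGraph G p i) f) :
    μ ≤ rigidityEigenvalue G (lInfty d) p := by
  -- The kernel, where every block sums to zero, has codimension at most `d`; this is what the bound
  -- on eigenvalue number `d + 1` requires.
  let S : (V × Fin d → ℝ) →ₗ[ℝ] (Fin d → ℝ) :=
    { toFun := fun x i => ∑ v, x (v, i)
      map_add' := fun x y => by ext; simp [Finset.sum_add_distrib]
      map_smul' := fun c x => by ext; simp [Finset.mul_sum] }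
  have hrank := LinearMap.finrank_range_add_finrank_ker S
  have hrange : Module.finrank ℝ (LinearMap.range S) ≤ d :=
    (Submodule.finrank_le _).trans (by simp)
  rw [Module.finrank_fintype_fun_eq_card, Fintype.card_prod, Fintype.card_fin] at hrank
  refine le_nthEigenvalue _ (by omega) ?_ (LinearMap.ker S) ?_ ?_
  · rw [motionDim_lInfty, Fintype.card_prod, Fintype.card_fin]
    nlinarith
  · rw [motionDim_lInfty, Fintype.card_prod, Fintype.card_fin]
    omega
  · intro x hx
    have hq := two_mul_dotProduct_frameworkLaplacian G p hp x
    have hsum : 2 * μ * (x ⬝ᵥ x) ≤ ∑ i, energy (colourGraph G p i) (fun v => x (v, i)) := by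
      rw [dotProduct, Fintype.sum_prod_type_right, Finset.mul_sum]
      refine Finset.sum_le_sum fun i _ => ?_
      refine le_of_eq_of_le ?_ (h i _ (congrFun (LinearMap.mem_ker.1 hx) i))
      simp only [sq]
    linarith

theorem exists_one_le_rigidityEigenvalue {V : Type*} [Fintype V] (G : SimpleGraph V)
    (e : G ≃g octahedralGraph) : ∃ p : V → Fin 2 → ℝ, IsFramework G (lInfty 2) p ∧
      1 ≤ rigidityEigenvalue G (lInfty 2) p := by
  have hadj : ∀ v w, G.Adj v w ↔ (e v).1 ≠ (e w).1 := fun v w => e.map_rel_iff.symm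
  have hcard : Fintype.card V = 6 := by
    rw [Fintype.card_congr e.toEquiv]; simp
  set p : V → Fin 2 → ℝ := fun v j => (octahedronPlacement (e v) j : ℝ) with hp
  have hdom : ∀ v w i, IsDominant (p v - p w) i ↔ ∀ j, j ≠ i →
      (octahedronPlacement (e v) j - octahedronPlacement (e w) j).natAbs <
        (octahedronPlacement (e v) i - octahedronPlacement (e w) i).natAbs := fun v w i =>
    isDominant_intCast_iff _ _ i
  have hframe : IsFramework G (lInfty 2) p := by
    refine (isFramework_lInfty_iff G p).2 fun v w hvw => ?_
    obtain ⟨i, hi⟩ := octahedronPlacement_dominant (e v) (e w) ((hadj v w).1 hvw)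
    have hi' := (hdom v w i).2 hi
    refine ⟨fun h => ?_, i, hi'⟩
    obtain ⟨j, hj⟩ := exists_ne i
    have := hi' j hj
    simp [h] at this
  refine ⟨p, hframe, le_rigidityEigenvalue (by norm_num) (by omega) G p hframe fun i f hf => ?_⟩
  have hbij : Function.Bijective (octahedronHexagon i) :=
    (Fintype.bijective_iff_injective_and_card _).2 ⟨octahedronHexagon_injective i, by simp⟩
  rw [mul_one]
  refine two_mul_sum_sq_le_energy_of_iso_cycleGraph
    ((Equiv.ofBijective _ hbij).trans e.symm.toEquiv) (fun a b => ?_) hf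
  rw [colourGraph_adj, hadj, hdom, ← octahedronHexagon_adj i a b]
  simp

end NormedRigidity

end

/-- Let `d ≥ 2` and let `G` be a finite simple graph with at least `d + 1` vertices and at most
`d |V|` edges. The rigidity eigenvalues of the frameworks of `G` in `ℓ_∞^d` form a nonempty set
that is bounded above, so that `a(G, ℓ_∞^d)` is a genuine supremum; it is at most `1`, and it
equals `1` exactly if `d = 2` and `G` is the octahedral graph. -/
theorem theoremt (d : ℕ) (hd : 2 ≤ d) {V : Type*} [Fintype V] (G : SimpleGraph V)
    (hV : d + 1 ≤ Fintype.card V) (hE : G.edgeSet.ncard ≤ d * Fintype.card V) :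
    (NormedRigidity.rigidityEigenvalues G (NormedRigidity.lInfty d)).Nonempty ∧
    BddAbove (NormedRigidity.rigidityEigenvalues G (NormedRigidity.lInfty d)) ∧
    NormedRigidity.algConnectivity G (NormedRigidity.lInfty d) ≤ 1 ∧
    (NormedRigidity.algConnectivity G (NormedRigidity.lInfty d) = 1 ↔
      d = 2 ∧ Nonempty (G ≃g NormedRigidity.octahedralGraph)) := by
  have hne := NormedRigidity.nonempty_rigidityEigenvalues (by omega : 0 < d) G
  have hfin := NormedRigidity.finite_rigidityEigenvalues (d := d) G
  have hle : ∀ r ∈ NormedRigidity.rigidityEigenvalues G (NormedRigidity.lInfty d), r ≤ 1 := by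
    rintro _ ⟨p, hp, rfl⟩
    rcases NormedRigidity.rigidityEigenvalue_lt_one_or hd G hV hE hp with h | h
    · exact h.le
    · exact h.1
  have hsup := csSup_le hne hle
  refine ⟨hne, ⟨1, hle⟩, hsup, fun h => ?_, ?_⟩
  -- Finiteness makes the supremum the value of an actual framework, to which the strict bounds
  -- apply.
  · have hmem := hne.csSup_mem hfin
    rw [← NormedRigidity.algConnectivity, h] at hmem
    obtain ⟨p, hp, h1⟩ := hmem
    rcases NormedRigidity.rigidityEigenvalue_lt_one_or hd G hV hE hp with h | h
    · exact absurd h1 h.ne'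
    · exact ⟨h.2.1, NormedRigidity.nonempty_iso_octahedralGraph G h.2.2.1 h.2.2.2⟩
  · rintro ⟨rfl, ⟨e⟩⟩
    obtain ⟨p, hp, h1⟩ := NormedRigidity.exists_one_le_rigidityEigenvalue G e
    exact le_antisymm hsup (h1.trans (le_csSup ⟨1, hle⟩ ⟨p, hp, rfl⟩))
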